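/- Let $(\Omega,\mathcal F,P)$ be a probability space carrying, for $i=1,2,\dots$, random variables $x_i\in\mathbb R^p$ and $D_i,\theta_i,y_i\in\mathbb R$. Suppose the Fay--Herriot model is correctly specified with true parameter $\psi_*=(\beta_*,A_*)$: for every $i$, $$\theta_i\mid x_i,D_i\sim N(x_i^\top\beta_*,A_*),\qquad y_i\mid \theta_i,x_i,D_i\sim N(\theta_i,D_i).$$ Assume: 1. the vectors $(y_i,x_i,D_i)$, $i\ge 1$, are independent and identically distributed, and there are constants $0<D_L\le D_U<\infty$ with $D_L\le D_i\le D_U$ almost surely; 2. $x_i\in\mathcal X$ almost surely for a bounded set $\mathcal X\subset\mathbb R^p$, and $E[x_ix_i^\top]$ is positive definite; 3. $\Psi\subset\mathbb R^p\times(0,\infty)$ is compact, $\psi_*\in\Psi$, and $A_*+D_L>(2\pi)^{-1}e^{-3}$. Let $\phi(\cdot;\mu,v)$ be the density of $N(\mu,v)$. For $\gamma\in(0,1]$, $\psi=(\beta,A)$, and $v_i=A+D_i$, put $$\mathcal D_\gamma(y_i;\psi)=\frac1\gamma\,\phi(y_i;x_i^\top\beta,v_i)^\gamma\,c_\gamma,\qquad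 \mathcal D_0(y_i;\psi)=\log\phi(y_i;x_i^\top\beta,v_i),$$ where $c_\gamma$ is, throughout, either $\{\int\phi(t;x_i^\top\beta,v_i)^{1+\gamma}dt\}^{-\gamma/(1+\gamma)}$ or $(2\pi v_i)^{\gamma^2/(2(1+\gamma))}$ (the two differ by a factor depending only on $\gamma$; the statement holds for either choice). Define $$\tilde\theta_i^{(\gamma)}(\psi)=y_i+D_i\frac{d}{dy_i}\mathcal D_\gamma(y_i;\psi),\qquad \tilde s_i^{2(\gamma)}(\psi)=D_i+D_i^2\frac{d^2}{dy_i^2}\mathcal D_\gamma(y_i;\psi).$$ Let $\Gamma\subset[0,1]$ be a fixed finite set containing $0$ and $1$. For $m\ge1$ and $\gamma\in\Gamma$ let $\hat\psi^{(\gamma)}$ be a (measurable) maximizer over $\Psi$ of $\sum_{i=1}^m\mathcal D_\gamma(y_i;\psi)$, and put $\hat\theta_i^{(\gamma)}=\tilde\theta_i^{(\gamma)}(\hat\psi^{(\gamma)})$ and $\hat s_i^{2(\gamma)}=\tilde s_i^{2(\gamma)}(\hat\psi^{(\gamma)})$. Let $\gamma_{op}$ be a (measurable) minimizer over $\gamma\in\Gamma$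 of $\sum_{i=1}^m\hat s_i^{2(\gamma)}$. For $\alpha\in(0,1)$ let $z_{\alpha/2}$ be the upper $\alpha/2$-quantile of $N(0,1)$ and $$\hat I_{i,1-\alpha}^{(\gamma)}=\bigl(\hat\theta_i^{(\gamma)}-z_{\alpha/2}\hat s_i^{(\gamma)},\ \hat\theta_i^{(\gamma)}+z_{\alpha/2}\hat s_i^{(\gamma)}\bigr),\qquad \hat s_i^{(\gamma)}=\sqrt{\max(\hat s_i^{2(\gamma)},0)}.$$ Then for every fixed $i$ and every $\alpha\in(0,1)$, $$P\bigl(\theta_i\in\hat I_{i,1-\alpha}^{(\gamma_{op})}\bigr)=1-\alpha+o(1)\qquad\text{as } m\to\infty.$$ -/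

import Mathlib

open MeasureTheory ProbabilityTheory Filter Topology

noncomputable section

namespace FayHerriot

/-- The covariate / coefficient space `ℝ^p`. -/
abbrev Cov (p : ℕ) : Type := EuclideanSpace ℝ (Fin p)

/-- The parameter space `ℝ^p × ℝ`; a parameter is `ψ = (β, A)`. -/
abbrev Param (p : ℕ) : Type := Cov p × ℝ

/-- The normal density `φ(y; μ, v)` with mean `μ` and variance `v`. -/
def phi (y μ v : ℝ) : ℝ := gaussianPDFReal μ v.toNNReal y

/-- The normalising factor of the `γ`-divergence, `(∫ φ(t; μ, v)^(1+γ) dt)^(-γ/(1+γ))`. -/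
def normIntegral (γ μ v : ℝ) : ℝ := (∫ t : ℝ, phi t μ v ^ (1 + γ)) ^ (-(γ / (1 + γ)))

/-- The closed form `(2πv)^(γ²/(2(1+γ)))`. It differs from `normIntegral` by the factor
`(1+γ)^(γ/(2(1+γ)))`, which depends on `γ` only. -/
def normClosed (γ _μ v : ℝ) : ℝ := (2 * Real.pi * v) ^ (γ ^ 2 / (2 * (1 + γ)))

/-- The generalized log-likelihood `𝒟_γ` of one observation `y` with marginal law `N(μ, v)`, for the
normalising factor `c`; for `γ = 0` it is the marginal log-likelihood. -/
def genLogLik (c : ℝ → ℝ → ℝ → ℝ) (γ μ v y : ℝ) : ℝ :=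
  if γ = 0 then Real.log (phi y μ v) else 1 / γ * phi y μ v ^ γ * c γ μ v

/-- `𝒟_γ(y; ψ)` for an area with covariate `x` and sampling variance `d`: the marginal law of `y`
is `N(xᵀβ, A + d)`. -/
def areaLik {p : ℕ} (c : ℝ → ℝ → ℝ → ℝ) (γ : ℝ) (ψ : Param p) (x : Cov p) (d y : ℝ) : ℝ :=
  genLogLik c γ (inner ℝ x ψ.1) (ψ.2 + d) y

/-- Robust posterior mean (Tweedie's formula): `y + d · ∂_y 𝒟_γ(y; ψ)`. -/
def postMean {p : ℕ} (c : ℝ → ℝ → ℝ → ℝ) (γ : ℝ) (ψ : Param p) (x : Cov p) (d y : ℝ) : ℝ :=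
  y + d * deriv (fun t => areaLik c γ ψ x d t) y

/-- Robust posterior variance (Tweedie's formula): `d + d² · ∂_y² 𝒟_γ(y; ψ)`. -/
def postVar {p : ℕ} (c : ℝ → ℝ → ℝ → ℝ) (γ : ℝ) (ψ : Param p) (x : Cov p) (d y : ℝ) : ℝ :=
  d + d ^ 2 * iteratedDeriv 2 (fun t => areaLik c γ ψ x d t) y

/-- The upper `q`-quantile of the standard normal distribution. -/
def upperQuantile (q : ℝ) : ℝ := sInf {t : ℝ | 1 - q ≤ cdf (gaussianReal 0 1) t}

/-- The robust confidence interval of nominal level `1 - α`, for parameter value `ψ`. -/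
def robustInterval {p : ℕ} (c : ℝ → ℝ → ℝ → ℝ) (α γ : ℝ) (ψ : Param p) (x : Cov p) (d y : ℝ) :
    Set ℝ :=
  Set.Ioo (postMean c γ ψ x d y - upperQuantile (α / 2) * √(postVar c γ ψ x d y))
    (postMean c γ ψ x d y + upperQuantile (α / 2) * √(postVar c γ ψ x d y))

/-- `ψ` maximizes `∑_{j<m} 𝒟_γ(y_j; ·)` over the parameter space `Ψ`. -/
def IsGammaEstimate {p : ℕ} (c : ℝ → ℝ → ℝ → ℝ) (Ψ : Set (Param p)) (γ : ℝ) (m : ℕ)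
    (x : ℕ → Cov p) (D y : ℕ → ℝ) (ψ : Param p) : Prop :=
  ψ ∈ Ψ ∧ ∀ ψ' ∈ Ψ, ∑ j ∈ Finset.range m, areaLik c γ ψ' (x j) (D j) (y j) ≤
    ∑ j ∈ Finset.range m, areaLik c γ ψ (x j) (D j) (y j)

/-- `g` minimizes over `Γ` the total robust variance `∑_{j<m} ŝ_j^{2(γ)}`, where `ψhat γ` is the
estimate belonging to `γ`. -/
def IsOptimalGamma {p : ℕ} (c : ℝ → ℝ → ℝ → ℝ) (Γ : Finset ℝ) (m : ℕ) (ψhat : ℝ → Param p)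
    (x : ℕ → Cov p) (D y : ℕ → ℝ) (g : ℝ) : Prop :=
  g ∈ Γ ∧ ∀ γ ∈ Γ, ∑ j ∈ Finset.range m, postVar c g (ψhat g) (x j) (D j) (y j) ≤
    ∑ j ∈ Finset.range m, postVar c γ (ψhat γ) (x j) (D j) (y j)

/-- The correctly specified two-stage normal model for one area: given `(x, D)`,
`θ ~ N(xᵀβ, A)`, and given `(x, D, θ)`, `y ~ N(θ, D)`. -/
structure IsModel {Ω : Type*} [MeasurableSpace Ω] (P : Measure Ω) [IsFiniteMeasure P] {p : ℕ}
    (β : Cov p) (A : ℝ) (x : Ω → Cov p) (D θ y : Ω → ℝ) : Prop where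
  area_level : ∀ᵐ z ∂(P.map fun ω => (x ω, D ω)),
    condDistrib θ (fun ω => (x ω, D ω)) P z = gaussianReal (inner ℝ z.1 β) A.toNNReal
  sampling_level : ∀ᵐ z ∂(P.map fun ω => (x ω, D ω, θ ω)),
    condDistrib y (fun ω => (x ω, D ω, θ ω)) P z = gaussianReal z.2.2 z.2.1.toNNReal

end FayHerriot

end

/-! Each `γ`-estimator maximizes a sample mean whose population version is uniquely maximal at the
true parameter, so by the uniform law of large numbers all of them are consistent, and for each `γ`
the average of the robust variances `ŝ²` converges to its expectation at the true parameter. That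
expectation is smallest at `γ = 0` only: for `γ > 0` the expected curvature of `-𝒟_γ` in `y` is
strictly below that of `-𝒟_0`, because the marginal variances exceed `(2π)⁻¹ exp (-3)`. Hence,
almost surely, `γop = 0` for all large `m`, and the interval is then the Bayes credible interval at
a consistent estimate. At the true parameter its pivot is a rotation of the two standardized errors
of the hierarchical model, hence standard normal. -/

namespace FayHerriot

open Real

section ClosedForms

lemma phi_of_pos {v : ℝ} (hv : 0 < v) (y μ : ℝ) :
    phi y μ v = (√(2 * π * v))⁻¹ * exp (-(y - μ) ^ 2 / (2 * v)) := by
  simp [phi, gaussianPDFReal, coe_toNNReal v hv.le]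

lemma phi_rpow {v : ℝ} (hv : 0 < v) (γ y μ : ℝ) :
    phi y μ v ^ γ = (2 * π * v) ^ (-(γ / 2)) * exp (-(γ * (y - μ) ^ 2 / (2 * v))) := by
  have h2 : 0 < 2 * π * v := by positivity
  rw [phi_of_pos hv, mul_rpow (by positivity) (by positivity), ← exp_mul, sqrt_eq_rpow,
    ← rpow_neg h2.le, ← rpow_mul h2.le]
  congr 2 <;> ring

lemma log_phi {v : ℝ} (hv : 0 < v) (y μ : ℝ) :
    log (phi y μ v) = -(1 / 2) * log (2 * π * v) - (y - μ) ^ 2 / (2 * v) := by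
  have h2 : 0 < 2 * π * v := by positivity
  rw [phi_of_pos hv, log_mul (by positivity) (by positivity), log_inv, log_exp, log_sqrt h2.le]
  ring

lemma integral_phi_rpow {v q : ℝ} (hv : 0 < v) (hq : 0 < q) (μ : ℝ) :
    ∫ t : ℝ, phi t μ v ^ q = (2 * π * v) ^ ((1 - q) / 2) * q ^ (-(1 / 2) : ℝ) := by
  have h2 : 0 < 2 * π * v := by positivity
  have hexp (t : ℝ) : exp (-(q * (t - μ) ^ 2 / (2 * v)))
      = exp (-(q / (2 * v)) * (t - μ) ^ 2) := by congr 1; ring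
  have hπ : π / (q / (2 * v)) = 2 * π * v * q⁻¹ := by field_simp
  simp_rw [phi_rpow hv, hexp]
  rw [integral_const_mul, integral_sub_right_eq_self (fun t => exp (-(q / (2 * v)) * t ^ 2)) μ,
    integral_gaussian, hπ, sqrt_eq_rpow, mul_rpow h2.le (by positivity), ← mul_assoc,
    ← rpow_add h2, inv_rpow hq.le, ← rpow_neg hq.le]
  congr 2
  ring

lemma normIntegral_eq {v γ : ℝ} (hv : 0 < v) (hγ : 0 < 1 + γ) (μ : ℝ) :
    normIntegral γ μ v = (1 + γ) ^ (γ / (2 * (1 + γ))) * normClosed γ μ v := by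
  have h2 : 0 < 2 * π * v := by positivity
  rw [normIntegral, integral_phi_rpow hv hγ, mul_rpow (by positivity) (by positivity),
    ← rpow_mul h2.le, ← rpow_mul hγ.le, normClosed, mul_comm]
  congr 2 <;> field_simp
  ring

/-- The normalizing factor `c` is `k γ` times the closed form, where `k γ` does not exceed the
constant of the integral form. Since `𝒟_0` does not involve `c`, nothing is asked of `c` at `γ = 0`,
and `k 0 = 1` is a convention under which the formulas for the derivatives hold for all `γ ≥ 0`. -/
structure IsNormFactor (c : ℝ → ℝ → ℝ → ℝ) (k : ℝ → ℝ) : Prop where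
  zero : k 0 = 1
  pos : ∀ γ, 0 ≤ γ → 0 < k γ
  le : ∀ γ, 0 < γ → k γ ≤ (1 + γ) ^ (γ / (2 * (1 + γ)))
  eq : ∀ γ μ v, 0 < γ → 0 < v → c γ μ v = k γ * normClosed γ μ v

lemma exists_isNormFactor {c : ℝ → ℝ → ℝ → ℝ} (hc : c = normIntegral ∨ c = normClosed) :
    ∃ k, IsNormFactor c k := by
  rcases hc with rfl | rfl
  · exact ⟨fun γ => (1 + γ) ^ (γ / (2 * (1 + γ))), by simp, fun γ h => by positivity,
      fun γ _ => le_rfl, fun γ μ v h hv => normIntegral_eq hv (by linarith) μ⟩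
  · exact ⟨fun _ => 1, rfl, fun _ _ => one_pos,
      fun γ h => one_le_rpow (by linarith) (by positivity), fun γ μ v _ _ => (one_mul _).symm⟩

/-- The power `(2πv)^(-γ/(2(1+γ)))` of the marginal variance left as a factor of `𝒟_γ` once the
normalizing factor has been multiplied out. -/
noncomputable def varWeight (γ v : ℝ) : ℝ := (2 * π * v) ^ (-(γ / (2 * (1 + γ))))

lemma varWeight_pos {v : ℝ} (hv : 0 < v) (γ : ℝ) : 0 < varWeight γ v := by
  unfold varWeight; positivity

lemma log_varWeight {v : ℝ} (hv : 0 < v) (γ : ℝ) :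
    log (varWeight γ v) = -(γ / (2 * (1 + γ))) * (log (2 * π) + log v) := by
  rw [varWeight, log_rpow (by positivity), log_mul (by positivity) hv.ne']

/-- The closed form of `-∂_y² 𝒟_γ(y)` for a normalizing factor equal to `k` times the closed form
`normClosed`. -/
noncomputable def curvature (k γ μ v y : ℝ) : ℝ :=
  k * varWeight γ v * v⁻¹ * ((1 - γ * ((y - μ) ^ 2 / v)) * exp (-(γ * (y - μ) ^ 2 / (2 * v))))

lemma curvature_one_zero (μ v y : ℝ) : curvature 1 0 μ v y = v⁻¹ := by simp [curvature, varWeight]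

variable {c : ℝ → ℝ → ℝ → ℝ} {k : ℝ → ℝ}

lemma genLogLik_zero (c : ℝ → ℝ → ℝ → ℝ) {v : ℝ} (hv : 0 < v) (μ y : ℝ) :
    genLogLik c 0 μ v y = -(1 / 2) * log (2 * π * v) - (y - μ) ^ 2 / (2 * v) := by
  rw [genLogLik, if_pos rfl, log_phi hv]

lemma genLogLik_of_pos (hk : IsNormFactor c k) {γ v : ℝ} (hγ : 0 < γ) (hv : 0 < v) (μ y : ℝ) :
    genLogLik c γ μ v y = k γ / γ * varWeight γ v * exp (-(γ * (y - μ) ^ 2 / (2 * v))) := by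
  have hexponent : -(γ / (2 * (1 + γ))) = -(γ / 2) + γ ^ 2 / (2 * (1 + γ)) := by
    field_simp; ring
  rw [genLogLik, if_neg hγ.ne', phi_rpow hv, hk.eq γ μ v hγ hv, normClosed, varWeight, hexponent,
    rpow_add (by positivity)]
  ring

lemma hasDerivAt_genLogLik (hk : IsNormFactor c k) {γ v : ℝ} (hγ : 0 ≤ γ) (hv : 0 < v)
    (μ y : ℝ) :
    HasDerivAt (genLogLik c γ μ v)
      (-(k γ * varWeight γ v * ((y - μ) / v) * exp (-(γ * (y - μ) ^ 2 / (2 * v))))) y := by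
  have hsq : HasDerivAt (fun y : ℝ => (y - μ) ^ 2 / (2 * v)) ((y - μ) / v) y := by
    refine ((((hasDerivAt_id y).sub_const μ).pow 2).div_const (2 * v)).congr_deriv ?_
    simp; field_simp
  rcases hγ.eq_or_lt with rfl | hγ
  · rw [funext (genLogLik_zero c hv μ)]
    refine (hsq.const_sub _).congr_deriv ?_
    simp [hk.zero, varWeight]
  · simp_rw [funext (genLogLik_of_pos hk hγ hv μ), mul_div_assoc γ]
    refine ((hsq.const_mul γ).neg.exp.const_mul (k γ / γ * varWeight γ v)).congr_deriv ?_
    simp only [Pi.neg_apply]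
    field_simp

lemma iteratedDeriv_two_genLogLik (hk : IsNormFactor c k) {γ v : ℝ} (hγ : 0 ≤ γ) (hv : 0 < v)
    (μ y : ℝ) : iteratedDeriv 2 (genLogLik c γ μ v) y = -curvature (k γ) γ μ v y := by
  have hexp : HasDerivAt (fun y : ℝ => γ * (y - μ) ^ 2 / (2 * v)) (γ * ((y - μ) / v)) y := by
    refine (((((hasDerivAt_id y).sub_const μ).pow 2).const_mul γ).div_const (2 * v)).congr_deriv ?_
    simp; field_simp
  have hlin : HasDerivAt (fun y : ℝ => k γ * varWeight γ v * ((y - μ) / v))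
      (k γ * varWeight γ v * (1 / v)) y :=
    (((hasDerivAt_id y).sub_const μ).div_const v).const_mul _
  rw [iteratedDeriv_succ, iteratedDeriv_one,
    funext fun y => (hasDerivAt_genLogLik hk hγ hv μ y).deriv]
  refine ((hlin.mul hexp.neg.exp).neg.congr_deriv ?_).deriv
  simp only [curvature, Pi.neg_apply]
  field_simp
  ring

variable {p : ℕ}

lemma postVar_eq (hk : IsNormFactor c k) {γ : ℝ} (hγ : 0 ≤ γ) {ψ : Param p} {d : ℝ}
    (hv : 0 < ψ.2 + d) (x : Cov p) (y : ℝ) :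
    postVar c γ ψ x d y = d - d ^ 2 * curvature (k γ) γ (inner ℝ x ψ.1) (ψ.2 + d) y := by
  change d + d ^ 2 * iteratedDeriv 2 (genLogLik c γ _ _) y = _
  rw [iteratedDeriv_two_genLogLik hk hγ hv]
  ring

/-- The mean of the Bayes posterior of `θ` given `(x, D, y) = (x, d, y)` under `ψ`. -/
noncomputable def posteriorMean (ψ : Param p) (x : Cov p) (d y : ℝ) : ℝ :=
  (ψ.2 * y + d * inner ℝ x ψ.1) / (ψ.2 + d)

/-- The variance of the Bayes posterior of `θ` given `D = d` under `ψ`. -/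
noncomputable def posteriorVar (ψ : Param p) (d : ℝ) : ℝ := ψ.2 * d / (ψ.2 + d)

/-- The symmetric Bayes credible interval for `θ`, of half-width `z` posterior standard
deviations. -/
noncomputable def credibleInterval (z : ℝ) (ψ : Param p) (x : Cov p) (d y : ℝ) : Set ℝ :=
  Set.Ioo (posteriorMean ψ x d y - z * √(posteriorVar ψ d))
    (posteriorMean ψ x d y + z * √(posteriorVar ψ d))

lemma postMean_zero (hk : IsNormFactor c k) {ψ : Param p} {d : ℝ} (hv : 0 < ψ.2 + d) (x : Cov p)
    (y : ℝ) : postMean c 0 ψ x d y = posteriorMean ψ x d y := by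
  change y + d * deriv (genLogLik c 0 _ _) y = _
  rw [(hasDerivAt_genLogLik hk le_rfl hv _ y).deriv, posteriorMean, hk.zero]
  simp only [varWeight, zero_div, neg_zero, rpow_zero, zero_mul, exp_zero, one_mul, mul_one]
  field_simp
  ring

lemma postVar_zero (hk : IsNormFactor c k) {ψ : Param p} {d : ℝ} (hv : 0 < ψ.2 + d) (x : Cov p)
    (y : ℝ) : postVar c 0 ψ x d y = posteriorVar ψ d := by
  rw [postVar_eq hk le_rfl hv, hk.zero, curvature_one_zero, posteriorVar]
  field_simp
  ring

lemma robustInterval_zero (hk : IsNormFactor c k) {ψ : Param p} {d : ℝ} (hv : 0 < ψ.2 + d)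
    (α : ℝ) (x : Cov p) (y : ℝ) :
    robustInterval c α 0 ψ x d y = credibleInterval (upperQuantile (α / 2)) ψ x d y := by
  rw [robustInterval, postMean_zero hk hv, postVar_zero hk hv, credibleInterval]

end ClosedForms

section GaussianExpectations

lemma integrable_sub_sq_gaussianReal (ν : ℝ) (s : NNReal) (μ : ℝ) :
    Integrable (fun y => (y - μ) ^ 2) (gaussianReal ν s) :=
  ((memLp_id_gaussianReal (μ := ν) (v := s) 2).sub (memLp_const μ)).integrable_sq

lemma integral_sub_sq_gaussianReal (ν : ℝ) (s : NNReal) (μ : ℝ) :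
    ∫ y, (y - μ) ^ 2 ∂gaussianReal ν s = (ν - μ) ^ 2 + s := by
  have hid : MemLp (fun y : ℝ => y) 2 (gaussianReal ν s) := memLp_id_gaussianReal 2
  have hmean : ∫ y, (y - μ) ∂gaussianReal ν s = ν - μ := by
    rw [integral_sub (hid.integrable one_le_two) (integrable_const μ), integral_id_gaussianReal]
    simp
  have hvar := variance_eq_sub (hid.sub (memLp_const μ))
  change Var[fun y : ℝ => y - μ; gaussianReal ν s]
    = ∫ y, (y - μ) ^ 2 ∂gaussianReal ν s - (∫ y, (y - μ) ∂gaussianReal ν s) ^ 2 at hvar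
  rw [hmean, variance_sub_const hid.aestronglyMeasurable, variance_fun_id_gaussianReal] at hvar
  linarith

-- Completing the square in `y`.
lemma gaussianPDFReal_mul_exp {γ v w : ℝ} (hγ : 0 ≤ γ) (hv : 0 < v) (hw : 0 < w) (μ ν y : ℝ) :
    gaussianPDFReal ν w.toNNReal y * exp (-(γ * (y - μ) ^ 2 / (2 * v)))
      = (√(1 + γ * w / v))⁻¹ * exp (-(γ * (ν - μ) ^ 2 / (2 * (v + γ * w))))
        * gaussianPDFReal ((v * ν + γ * w * μ) / (v + γ * w)) (v * w / (v + γ * w)).toNNReal y := by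
  simp only [gaussianPDFReal, coe_toNNReal _ hw.le, coe_toNNReal (v * w / (v + γ * w))
    (by positivity)]
  have hexp : exp (-(y - ν) ^ 2 / (2 * w)) * exp (-(γ * (y - μ) ^ 2 / (2 * v)))
      = exp (-(γ * (ν - μ) ^ 2 / (2 * (v + γ * w))))
        * exp (-(y - (v * ν + γ * w * μ) / (v + γ * w)) ^ 2 / (2 * (v * w / (v + γ * w)))) := by
    rw [← exp_add, ← exp_add]
    congr 1
    field_simp
    ring
  have hsqrt : √(2 * π * w) = √(1 + γ * w / v) * √(2 * π * (v * w / (v + γ * w))) := by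
    rw [← sqrt_mul (by positivity)]
    congr 1
    field_simp
  rw [mul_assoc, hexp, hsqrt, mul_inv]
  ring

lemma integral_mul_exp_gaussianReal {γ v w : ℝ} (hγ : 0 ≤ γ) (hv : 0 < v) (hw : 0 < w) (μ ν : ℝ)
    (g : ℝ → ℝ) :
    ∫ y, g y * exp (-(γ * (y - μ) ^ 2 / (2 * v))) ∂gaussianReal ν w.toNNReal
      = (√(1 + γ * w / v))⁻¹ * exp (-(γ * (ν - μ) ^ 2 / (2 * (v + γ * w))))
        * ∫ y, g y ∂gaussianReal ((v * ν + γ * w * μ) / (v + γ * w))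
            (v * w / (v + γ * w)).toNNReal := by
  rw [integral_gaussianReal_eq_integral_smul (toNNReal_pos.2 hw).ne',
    integral_gaussianReal_eq_integral_smul (toNNReal_pos.2 (by positivity)).ne',
    ← integral_const_mul]
  congr 1 with y
  simp only [smul_eq_mul]
  rw [mul_left_comm, gaussianPDFReal_mul_exp hγ hv hw]
  ring

variable {c : ℝ → ℝ → ℝ → ℝ} {k : ℝ → ℝ}

lemma integral_genLogLik_zero (c : ℝ → ℝ → ℝ → ℝ) {v w : ℝ} (hv : 0 < v) (hw : 0 < w)
    (μ ν : ℝ) :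
    ∫ y, genLogLik c 0 μ v y ∂gaussianReal ν w.toNNReal
      = -(1 / 2) * log (2 * π * v) - ((ν - μ) ^ 2 + w) / (2 * v) := by
  simp_rw [genLogLik_zero c hv]
  rw [integral_sub (integrable_const _) ((integrable_sub_sq_gaussianReal _ _ _).div_const _),
    integral_div, integral_sub_sq_gaussianReal, coe_toNNReal _ hw.le]
  simp

lemma integral_genLogLik_of_pos (hk : IsNormFactor c k) {γ v w : ℝ} (hγ : 0 < γ) (hv : 0 < v)
    (hw : 0 < w) (μ ν : ℝ) :
    ∫ y, genLogLik c γ μ v y ∂gaussianReal ν w.toNNReal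
      = k γ / γ * (varWeight γ v * (√(1 + γ * w / v))⁻¹)
        * exp (-(γ * (ν - μ) ^ 2 / (2 * (v + γ * w)))) := by
  have h := integral_mul_exp_gaussianReal hγ.le hv hw μ ν fun _ => 1
  simp only [one_mul, integral_const, probReal_univ, smul_eq_mul, mul_one] at h
  simp_rw [genLogLik_of_pos hk hγ hv]
  rw [integral_const_mul, h]
  ring

-- After taking logarithms this is strict concavity of `log` between `1` and `w / v`.
lemma varWeight_mul_lt {γ v w : ℝ} (hγ : 0 < γ) (hv : 0 < v) (hw : 0 < w) (hne : v ≠ w) :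
    varWeight γ v * (√(1 + γ * w / v))⁻¹ < varWeight γ w * (√(1 + γ))⁻¹ := by
  have hγ1 : 0 < 1 + γ := by linarith
  have hu : 0 < 1 + γ * w / v := by positivity
  have hconcave : γ / (1 + γ) * (log w - log v) < log (1 + γ * w / v) - log (1 + γ) := by
    have hne1 : (1 : ℝ) ≠ w / v := fun h => hne (by field_simp at h; exact h)
    have h := strictConcaveOn_log_Ioi.2 (Set.mem_Ioi.2 one_pos) (Set.mem_Ioi.2 (div_pos hw hv))
      hne1 (by positivity : 0 < 1 / (1 + γ)) (by positivity : 0 < γ / (1 + γ)) (by field_simp)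
    have hmean : 1 / (1 + γ) + γ / (1 + γ) * (w / v) = (1 + γ * w / v) / (1 + γ) := by field_simp
    simpa only [smul_eq_mul, log_one, mul_zero, zero_add, mul_one, hmean, log_div hu.ne' hγ1.ne',
      log_div hw.ne' hv.ne'] using h
  have hWv := varWeight_pos hv γ
  have hWw := varWeight_pos hw γ
  rw [← log_lt_log_iff (by positivity) (by positivity), log_mul hWv.ne' (by positivity),
    log_mul hWw.ne' (by positivity), log_inv, log_inv, log_sqrt hu.le, log_sqrt hγ1.le,
    log_varWeight hv, log_varWeight hw, mul_comm 2 (1 + γ), ← div_div]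
  linarith

lemma integral_genLogLik_zero_lt (c : ℝ → ℝ → ℝ → ℝ) {v w μ ν : ℝ} (hv : 0 < v) (hw : 0 < w)
    (hne : (μ, v) ≠ (ν, w)) :
    ∫ y, genLogLik c 0 μ v y ∂gaussianReal ν w.toNNReal
      < ∫ y, genLogLik c 0 ν w y ∂gaussianReal ν w.toNNReal := by
  have hw2 : ((ν - ν) ^ 2 + w) / (2 * w) = 1 / 2 := by simp; field_simp
  rw [integral_genLogLik_zero c hv hw, integral_genLogLik_zero c hw hw, hw2, add_div,
    log_mul (by positivity) hv.ne', log_mul (by positivity) hw.ne']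
  have hwv : w / (2 * v) = w / v / 2 := by field_simp
  by_cases hvw : v = w
  · subst hvw
    have hμ : ν - μ ≠ 0 := fun h => hne (by rw [sub_eq_zero.1 h])
    have : 0 < (ν - μ) ^ 2 / (2 * v) := by positivity
    have : v / v = 1 := div_self hv.ne'
    linarith
  · have hlog := log_lt_sub_one_of_pos (div_pos hw hv)
      (fun h => hvw (by field_simp at h; exact h.symm))
    rw [log_div hw.ne' hv.ne'] at hlog
    have : 0 ≤ (ν - μ) ^ 2 / (2 * v) := by positivity
    linarith

lemma integral_genLogLik_lt_of_pos (hk : IsNormFactor c k) {γ v w μ ν : ℝ} (hγ : 0 < γ)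
    (hv : 0 < v) (hw : 0 < w) (hne : (μ, v) ≠ (ν, w)) :
    ∫ y, genLogLik c γ μ v y ∂gaussianReal ν w.toNNReal
      < ∫ y, genLogLik c γ ν w y ∂gaussianReal ν w.toNNReal := by
  rw [integral_genLogLik_of_pos hk hγ hv hw, integral_genLogLik_of_pos hk hγ hw hw]
  have hkγ : 0 < k γ / γ := div_pos (hk.pos γ hγ.le) hγ
  have hWv := varWeight_pos hv γ
  have hww : γ * w / w = γ := mul_div_cancel_right₀ γ hw.ne'
  simp only [sub_self, ne_eq, OfNat.ofNat_ne_zero, not_false_eq_true, zero_pow, mul_zero, zero_div,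
    neg_zero, exp_zero, mul_one, hww]
  by_cases hvw : v = w
  · subst hvw
    have hμ : ν - μ ≠ 0 := fun h => hne (by rw [sub_eq_zero.1 h])
    rw [hww]
    refine mul_lt_of_lt_one_right (by positivity) (exp_lt_one_iff.2 (neg_lt_zero.2 ?_))
    positivity
  · refine (mul_le_of_le_one_right (by positivity) (exp_le_one_iff.2 (neg_nonpos.2 ?_))).trans_lt
      (mul_lt_mul_of_pos_left (varWeight_mul_lt hγ hv hw hvw) hkγ)
    positivity

lemma integral_genLogLik_lt (hk : IsNormFactor c k) {γ v w μ ν : ℝ} (hγ : 0 ≤ γ) (hv : 0 < v)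
    (hw : 0 < w) (hne : (μ, v) ≠ (ν, w)) :
    ∫ y, genLogLik c γ μ v y ∂gaussianReal ν w.toNNReal
      < ∫ y, genLogLik c γ ν w y ∂gaussianReal ν w.toNNReal := by
  rcases hγ.eq_or_lt with rfl | hγ
  · exact integral_genLogLik_zero_lt c hv hw hne
  · exact integral_genLogLik_lt_of_pos hk hγ hv hw hne

lemma integral_curvature {γ v : ℝ} (hγ : 0 ≤ γ) (hv : 0 < v) (k μ : ℝ) :
    ∫ y, curvature k γ μ v y ∂gaussianReal μ v.toNNReal
      = k * varWeight γ v * v⁻¹ * ((√(1 + γ))⁻¹ * (1 + γ)⁻¹) := by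
  have hmean : (v * μ + γ * v * μ) / (v + γ * v) = μ := by field_simp
  have hvar : v * v / (v + γ * v) = v / (1 + γ) := by field_simp
  simp only [curvature]
  rw [integral_const_mul, integral_mul_exp_gaussianReal hγ hv hv, hmean, hvar,
    mul_div_cancel_right₀ _ hv.ne', integral_sub (integrable_const _)
      (((integrable_sub_sq_gaussianReal _ _ _).div_const _).const_mul _), integral_const_mul,
    integral_div, integral_sub_sq_gaussianReal, coe_toNNReal _ (by positivity)]
  simp only [sub_self, ne_eq, OfNat.ofNat_ne_zero, not_false_eq_true, zero_pow, mul_zero, zero_div,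
    neg_zero, exp_zero, mul_one, zero_add, integral_const, probReal_univ, smul_eq_mul]
  congr 2
  field_simp
  ring

-- Since `2πv > e⁻³`, taking logarithms reduces the claim to `3γ ≤ (3 + 2γ) log (1 + γ)`, which
-- follows from `2γ / (γ + 2) ≤ log (1 + γ)`.
lemma mul_varWeight_lt {k γ v : ℝ} (hk : 0 < k) (hk' : k ≤ (1 + γ) ^ (γ / (2 * (1 + γ))))
    (hγ : 0 < γ) (hv3 : (2 * π)⁻¹ * exp (-3) < v) :
    k * varWeight γ v < √(1 + γ) * (1 + γ) := by
  have hv : 0 < v := hv3.trans' (by positivity)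
  have hγ1 : 0 < 1 + γ := by linarith
  have hW := varWeight_pos hv γ
  have hlogv : -3 < log (2 * π) + log v := by
    rw [← log_mul (by positivity) hv.ne', lt_log_iff_exp_lt (by positivity)]
    rwa [inv_mul_lt_iff₀ (by positivity)] at hv3
  have hlogk : log k ≤ γ / (2 * (1 + γ)) * log (1 + γ) := by
    rw [← log_rpow hγ1]; exact log_le_log hk hk'
  have hlogγ : 3 * γ ≤ (3 + 2 * γ) * log (1 + γ) :=
    calc 3 * γ ≤ (3 + 2 * γ) * (2 * γ / (γ + 2)) := by
          rw [mul_div_assoc', le_div_iff₀ (by positivity)]; nlinarith [sq_nonneg γ]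
      _ ≤ (3 + 2 * γ) * log (1 + γ) := by
          gcongr; exact le_log_one_add_of_nonneg hγ.le
  have hexponent : γ / (2 * (1 + γ)) * 3 ≤ (3 / 2 - γ / (2 * (1 + γ))) * log (1 + γ) :=
    calc γ / (2 * (1 + γ)) * 3 = 3 * γ / (2 * (1 + γ)) := by ring
      _ ≤ (3 + 2 * γ) * log (1 + γ) / (2 * (1 + γ)) := by gcongr
      _ = (3 / 2 - γ / (2 * (1 + γ))) * log (1 + γ) := by field_simp; ring
  have hq : γ / (2 * (1 + γ)) * -3 < γ / (2 * (1 + γ)) * (log (2 * π) + log v) := by gcongr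
  rw [← log_lt_log_iff (by positivity) (by positivity), log_mul hk.ne' hW.ne',
    log_mul (by positivity) hγ1.ne', log_sqrt hγ1.le, log_varWeight hv]
  linarith

lemma integral_curvature_lt {k γ v : ℝ} (hk : 0 < k) (hk' : k ≤ (1 + γ) ^ (γ / (2 * (1 + γ))))
    (hγ : 0 < γ) (hv3 : (2 * π)⁻¹ * exp (-3) < v) (μ : ℝ) :
    ∫ y, curvature k γ μ v y ∂gaussianReal μ v.toNNReal < v⁻¹ := by
  have hv : 0 < v := hv3.trans' (by positivity)
  calc ∫ y, curvature k γ μ v y ∂gaussianReal μ v.toNNReal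
      = k * varWeight γ v * (√(1 + γ) * (1 + γ))⁻¹ * v⁻¹ := by
        rw [integral_curvature hγ.le hv, mul_inv]; ring
    _ < 1 * v⁻¹ := by
        gcongr
        rw [mul_inv_lt_iff₀ (by positivity), one_mul]
        exact mul_varWeight_lt hk hk' hγ hv3
    _ = v⁻¹ := one_mul _

end GaussianExpectations

section ConditionalGaussian

lemma gaussianReal_map_standardize (m : ℝ) {v : ℝ} (hv : 0 < v) :
    (gaussianReal m v.toNNReal).map (fun y => (y - m) / √v) = gaussianReal 0 1 := by
  change (gaussianReal m v.toNNReal).map ((fun y => y / √v) ∘ (fun y => y - m)) = _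
  rw [← Measure.map_map (by fun_prop) (by fun_prop), gaussianReal_map_sub_const,
    gaussianReal_map_div_const]
  congr 1
  · simp
  · ext
    simp [sq_sqrt hv.le, coe_toNNReal _ hv.le, hv.ne']

lemma gaussianReal_map_add_sqrt_mul (μ v : ℝ) :
    (gaussianReal 0 1).map (fun r => μ + √v * r) = gaussianReal μ v.toNNReal := by
  change (gaussianReal 0 1).map ((fun t => μ + t) ∘ (fun r => √v * r)) = _
  rw [← Measure.map_map (by fun_prop) (by fun_prop), gaussianReal_map_const_mul,
    gaussianReal_map_const_add]
  congr 1
  · simp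
  · ext
    simp [sq_sqrt', Real.toNNReal]

lemma gaussianReal_prod_map_rotate {a b : ℝ} (hab : a ^ 2 + b ^ 2 = 1) :
    ((gaussianReal 0 1).prod (gaussianReal 0 1)).map (fun q : ℝ × ℝ => a * q.1 + b * q.2)
      = gaussianReal 0 1 := by
  change ((gaussianReal 0 1).prod (gaussianReal 0 1)).map
    ((fun q : ℝ × ℝ => q.1 + q.2) ∘ Prod.map (fun u => a * u) (fun w => b * w)) = _
  rw [← Measure.map_map (by fun_prop) (by fun_prop),
    ← Measure.map_prod_map _ _ (by fun_prop) (by fun_prop), gaussianReal_map_const_mul,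
    gaussianReal_map_const_mul]
  refine gaussianReal_conv_gaussianReal.trans ?_
  congr 1
  · simp
  · ext; simpa using hab

variable {Ω E : Type*} [MeasurableSpace Ω] [MeasurableSpace E]

lemma hasLaw_standardize {P : Measure Ω} [IsProbabilityMeasure P] {Z : Ω → E} {Y : Ω → ℝ}
    (hZ : Measurable Z) (hY : Measurable Y) {m v : E → ℝ} (hm : Measurable m) (hv : Measurable v)
    (hpos : ∀ᵐ z ∂(P.map Z), 0 < v z)
    (h : ∀ᵐ z ∂(P.map Z), condDistrib Y Z P z = gaussianReal (m z) (v z).toNNReal) :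
    HasLaw (fun ω => (Z ω, (Y ω - m (Z ω)) / √(v (Z ω))))
      ((P.map Z).prod (gaussianReal 0 1)) P := by
  refine ⟨by fun_prop, ?_⟩
  have hT : Measurable (fun q : E × ℝ => (q.1, (q.2 - m q.1) / √(v q.1))) := by fun_prop
  change P.map ((fun q : E × ℝ => (q.1, (q.2 - m q.1) / √(v q.1))) ∘ (fun ω => (Z ω, Y ω))) = _
  have : IsProbabilityMeasure (P.map Z) := Measure.isProbabilityMeasure_map hZ.aemeasurable
  rw [← Measure.map_map hT (by fun_prop), ← compProd_map_condDistrib hY.aemeasurable]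
  ext s hs
  rw [Measure.map_apply hT hs, Measure.compProd_apply (hT hs), Measure.prod_apply hs]
  refine lintegral_congr_ae ?_
  filter_upwards [hpos, h] with z hz hz'
  rw [hz', ← gaussianReal_map_standardize (m z) hz,
    Measure.map_apply (by fun_prop) (measurable_prodMk_left hs)]
  rfl

lemma hasLaw_rotate (Q : Measure E) {a b : E → ℝ} (ha : Measurable a)
    (hb : Measurable b) (hab : ∀ᵐ z ∂Q, a z ^ 2 + b z ^ 2 = 1) :
    HasLaw (fun q : (E × ℝ) × ℝ => (q.1.1, a q.1.1 * q.1.2 + b q.1.1 * q.2))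
      (Q.prod (gaussianReal 0 1)) ((Q.prod (gaussianReal 0 1)).prod (gaussianReal 0 1)) := by
  have hT : Measurable
      (fun q : (E × ℝ) × ℝ => (q.1.1, a q.1.1 * q.1.2 + b q.1.1 * q.2)) := by fun_prop
  refine ⟨hT.aemeasurable, ?_⟩
  ext s hs
  rw [Measure.map_apply hT hs, Measure.prod_apply (hT hs),
    lintegral_prod _ (measurable_measure_prodMk_left (hT hs)).aemeasurable, Measure.prod_apply hs]
  refine lintegral_congr_ae ?_
  filter_upwards [hab] with z hz
  have hR : Measurable (fun q : ℝ × ℝ => a z * q.1 + b z * q.2) := by fun_prop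
  have h := congrArg (fun ν : Measure ℝ => ν (Prod.mk z ⁻¹' s)) (gaussianReal_prod_map_rotate hz)
  simp only [Measure.map_apply hR (measurable_prodMk_left hs),
    Measure.prod_apply (hR (measurable_prodMk_left hs))] at h
  exact h

lemma sq_sqrt_div_sqrt_add {a b : ℝ} (ha : 0 < a) (hb : 0 < b) :
    (√a / √(a + b)) ^ 2 + (√b / √(a + b)) ^ 2 = 1 := by
  rw [div_pow, div_pow, sq_sqrt ha.le, sq_sqrt hb.le, sq_sqrt (by positivity), ← add_div,
    div_self (by positivity)]

variable {p : ℕ}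

/-- The conditional law `N(xᵀβ, A + D)` of `y` given `(x, D)`. -/
noncomputable def marginalKernel (β : Cov p) (A : ℝ) : Kernel (Cov p × ℝ) ℝ where
  toFun z := gaussianReal (inner ℝ z.1 β) (A + z.2).toNNReal
  measurable' := measurable_gaussianReal.comp (f := fun z : Cov p × ℝ =>
    (inner ℝ z.1 β, (A + z.2).toNNReal)) (by fun_prop)

instance (β : Cov p) (A : ℝ) : IsMarkovKernel (marginalKernel β A) :=
  ⟨fun _ => inferInstanceAs (IsProbabilityMeasure (gaussianReal _ _))⟩

/-- The law of `(y, (x, D))` when `(x, D)` has law `ν` and, given `(x, D)`, `y` is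
`N(xᵀβ, A + D)`. -/
noncomputable def marginalLaw (β : Cov p) (A : ℝ) (ν : Measure (Cov p × ℝ)) :
    Measure (ℝ × Cov p × ℝ) :=
  (ν ⊗ₘ marginalKernel β A).map Prod.swap

lemma marginalLaw_eq_map_prod (β : Cov p) (A : ℝ) (ν : Measure (Cov p × ℝ)) [SFinite ν] :
    marginalLaw β A ν = (ν.prod (gaussianReal 0 1)).map
      fun q => (inner ℝ q.1.1 β + √(A + q.1.2) * q.2, q.1) := by
  have hT : Measurable fun q : (Cov p × ℝ) × ℝ =>
      (inner ℝ q.1.1 β + √(A + q.1.2) * q.2, q.1) := by fun_prop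
  ext s hs
  rw [marginalLaw, Measure.map_apply measurable_swap hs,
    Measure.compProd_apply (measurable_swap hs), Measure.map_apply hT hs,
    Measure.prod_apply (hT hs)]
  refine lintegral_congr fun z => ?_
  change gaussianReal (inner ℝ z.1 β) (A + z.2).toNNReal (Prod.mk z ⁻¹' (Prod.swap ⁻¹' s)) = _
  rw [← gaussianReal_map_add_sqrt_mul,
    Measure.map_apply (by fun_prop) (measurable_prodMk_left (measurable_swap hs))]
  rfl

variable {P : Measure Ω} [IsProbabilityMeasure P] {β : Cov p} {A : ℝ} {x : Ω → Cov p}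
  {D θ y : Ω → ℝ}

lemma IsModel.hasLaw_errors (h : IsModel P β A x D θ y) (hA : 0 < A) (hx : Measurable x)
    (hD : Measurable D) (hθ : Measurable θ) (hy : Measurable y) (hDpos : ∀ᵐ ω ∂P, 0 < D ω) :
    HasLaw (fun ω => (((x ω, D ω), (θ ω - inner ℝ (x ω) β) / √A), (y ω - θ ω) / √(D ω)))
      (((P.map (fun ω => (x ω, D ω))).prod (gaussianReal 0 1)).prod (gaussianReal 0 1)) P := by
  have : IsProbabilityMeasure (P.map fun ω => (x ω, D ω, θ ω)) :=
    Measure.isProbabilityMeasure_map (by fun_prop)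
  have hinner : Measurable fun z : Cov p × ℝ × ℝ => inner ℝ z.1 β :=
    Measurable.inner_const measurable_fst
  have harea := hasLaw_standardize (Z := fun ω => (x ω, D ω)) (hx.prodMk hD) hθ
    (m := fun z => inner ℝ z.1 β) (v := fun _ => A) (Measurable.inner_const measurable_fst)
    measurable_const (ae_of_all _ fun _ => hA) h.area_level
  have hsampling := hasLaw_standardize (Z := fun ω => (x ω, D ω, θ ω)) (by fun_prop) hy
    (m := fun z => z.2.2) (v := fun z => z.2.1) (by fun_prop) (by fun_prop)
    ((ae_map_iff (by fun_prop) (measurableSet_lt (by fun_prop) (by fun_prop))).2 hDpos)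
    h.sampling_level
  have hT : Measurable (fun z : Cov p × ℝ × ℝ =>
      ((z.1, z.2.1), (z.2.2 - inner ℝ z.1 β) / √A)) := by fun_prop
  refine HasLaw.comp (Y := Prod.map (fun z : Cov p × ℝ × ℝ =>
    ((z.1, z.2.1), (z.2.2 - inner ℝ z.1 β) / √A)) id)
    ⟨(hT.prodMap measurable_id).aemeasurable, ?_⟩ hsampling
  rw [← Measure.map_prod_map _ _ hT measurable_id, Measure.map_map hT (by fun_prop),
    Measure.map_id, ← harea.map_eq]
  rfl

lemma IsModel.hasLaw_rotated_errors (h : IsModel P β A x D θ y) (hA : 0 < A) (hx : Measurable x)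
    (hD : Measurable D) (hθ : Measurable θ) (hy : Measurable y) (hDpos : ∀ᵐ ω ∂P, 0 < D ω)
    {a b : ℝ → ℝ} (ha : Measurable a) (hb : Measurable b)
    (hab : ∀ d, 0 < d → a d ^ 2 + b d ^ 2 = 1) :
    HasLaw (fun ω => ((x ω, D ω),
        a (D ω) * ((θ ω - inner ℝ (x ω) β) / √A) + b (D ω) * ((y ω - θ ω) / √(D ω))))
      ((P.map (fun ω => (x ω, D ω))).prod (gaussianReal 0 1)) P := by
  have hpos : ∀ᵐ z ∂(P.map fun ω => (x ω, D ω)), 0 < z.2 :=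
    (ae_map_iff (by fun_prop) (measurableSet_lt (by fun_prop) (by fun_prop))).2 hDpos
  exact (hasLaw_rotate _ (a := fun z => a z.2) (b := fun z => b z.2) (by fun_prop) (by fun_prop)
    (hpos.mono fun z hz => hab _ hz)).comp (h.hasLaw_errors hA hx hD hθ hy hDpos)

lemma IsModel.hasLaw_obs (h : IsModel P β A x D θ y) (hA : 0 < A) (hx : Measurable x)
    (hD : Measurable D) (hθ : Measurable θ) (hy : Measurable y) (hDpos : ∀ᵐ ω ∂P, 0 < D ω) :
    HasLaw (fun ω => (y ω, x ω, D ω)) (marginalLaw β A (P.map fun ω => (x ω, D ω))) P := by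
  have hinner : Measurable fun q : (Cov p × ℝ) × ℝ => inner ℝ q.1.1 β :=
    Measurable.inner_const (measurable_fst.comp measurable_fst)
  have hrot := h.hasLaw_rotated_errors hA hx hD hθ hy hDpos (a := fun d => √A / √(A + d))
    (b := fun d => √d / √(A + d)) (by fun_prop) (by fun_prop)
    fun d hd => sq_sqrt_div_sqrt_add hA hd
  have hlaw := (marginalLaw_eq_map_prod β A (P.map fun ω => (x ω, D ω))).symm
  refine (HasLaw.comp ⟨by fun_prop, hlaw⟩ hrot).congr ?_
  filter_upwards [hDpos] with ω hω
  simp only [Function.comp_apply, Prod.mk.injEq, and_true]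
  field_simp
  ring

-- With `u`, `w` the standardized errors of `θ` and `y`, the pivot is `(√D u - √A w) / √(A + D)`.
lemma IsModel.hasLaw_pivot (h : IsModel P β A x D θ y) (hA : 0 < A) (hx : Measurable x)
    (hD : Measurable D) (hθ : Measurable θ) (hy : Measurable y) (hDpos : ∀ᵐ ω ∂P, 0 < D ω) :
    HasLaw (fun ω => (θ ω - posteriorMean (β, A) (x ω) (D ω) (y ω)) / √(posteriorVar (β, A) (D ω)))
      (gaussianReal 0 1) P := by
  have : IsProbabilityMeasure (P.map fun ω => (x ω, D ω)) :=
    Measure.isProbabilityMeasure_map (by fun_prop)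
  have hrot := h.hasLaw_rotated_errors hA hx hD hθ hy hDpos (a := fun d => √d / √(A + d))
    (b := fun d => -(√A / √(A + d))) (by fun_prop) (by fun_prop)
    fun d hd => by rw [neg_sq, add_comm, sq_sqrt_div_sqrt_add hA hd]
  have hsnd : HasLaw Prod.snd (gaussianReal 0 1)
      ((P.map fun ω => (x ω, D ω)).prod (gaussianReal 0 1)) :=
    ⟨by fun_prop, by simp [Measure.map_snd_prod]⟩
  refine (hsnd.comp hrot).congr ?_
  filter_upwards [hDpos] with ω hω
  have hdiff : θ ω - posteriorMean (β, A) (x ω) (D ω) (y ω)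
      = (√(D ω) ^ 2 * (θ ω - inner ℝ (x ω) β) - √A ^ 2 * (y ω - θ ω)) / √(A + D ω) ^ 2 := by
    rw [posteriorMean, sq_sqrt hA.le, sq_sqrt hω.le, sq_sqrt (by positivity)]
    field_simp
    ring
  rw [hdiff, posteriorVar, sqrt_div' _ (by positivity), sqrt_mul hA.le]
  simp only [Function.comp_apply]
  field_simp
  ring

end ConditionalGaussian

section UniformLaw

open Finset (range)

/-- The average of `g` over the first `m` terms of the sequence `z`. -/
noncomputable def sampleMean {E : Type*} (g : E → ℝ) (z : ℕ → E) (m : ℕ) : ℝ :=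
  (m : ℝ)⁻¹ * ∑ j ∈ range m, g (z j)

variable {T : Type*} [TopologicalSpace T]

-- The parametrized average is an average of random elements of the Banach space `C(K, ℝ)`.
lemma tendstoUniformlyOn_sampleMean [T2Space T] [SecondCountableTopology T]
    {Ω E : Type*} [MeasurableSpace Ω] {P : Measure Ω} [TopologicalSpace E]
    [MeasurableSpace E] [OpensMeasurableSpace E] {Q : Measure E} {K : Set T} (hK : IsCompact K)
    {S : Set E} (hS : MeasurableSet S) (hQS : ∀ᵐ z ∂Q, z ∈ S) {f : T → E → ℝ}
    (hf : ContinuousOn (fun q : T × E => f q.1 q.2) (K ×ˢ S)) {b : E → ℝ} (hb : Integrable b Q)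
    (hfb : ∀ t ∈ K, ∀ z ∈ S, |f t z| ≤ b z) {Z : ℕ → Ω → E} (hZ : ∀ j, HasLaw (Z j) Q P)
    (hindep : Pairwise fun i j => IndepFun (Z i) (Z j) P) :
    ContinuousOn (fun t => ∫ z, f t z ∂Q) K ∧
    ∀ᵐ ω ∂P, TendstoUniformlyOn (fun m t => sampleMean (f t) (fun j => Z j ω) m)
      (fun t => ∫ z, f t z ∂Q) atTop K := by
  classical
  have : CompactSpace K := isCompact_iff_compactSpace.1 hK
  let _ : MeasurableSpace C(K, ℝ) := borel _
  have : BorelSpace C(K, ℝ) := ⟨rfl⟩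
  let F : C(S × K, ℝ) := ⟨fun q => f q.2 q.1, hf.comp_continuous
    (continuous_snd.subtype_val.prodMk continuous_fst.subtype_val) fun q => ⟨q.2.2, q.1.2⟩⟩
  let G : E → C(K, ℝ) := fun z => if h : z ∈ S then F.curry ⟨z, h⟩ else 0
  have hG : Measurable G := F.curry.continuous.measurable.dite measurable_const hS
  have hGf {z : E} (hz : z ∈ S) (t : K) : G z t = f t z := by simp [G, hz, F]
  have hGint : Integrable G Q := by
    refine hb.mono hG.aestronglyMeasurable ?_
    filter_upwards [hQS] with z hz
    refine (ContinuousMap.norm_le _ (norm_nonneg _)).2 fun t => ?_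
    rw [hGf hz]
    exact (hfb t t.2 z hz).trans (le_abs_self _)
  have hmean : ⇑(∫ z, G z ∂Q) = fun t : K => ∫ z, f t z ∂Q := by
    funext t
    rw [← ContinuousMap.evalCLM_apply ℝ t, ← (ContinuousMap.evalCLM ℝ t).integral_comp_comm hGint]
    exact integral_congr_ae (hQS.mono fun z hz => hGf hz t)
  have hlim : ∀ᵐ ω ∂P, Tendsto (fun m : ℕ => (m : ℝ)⁻¹ • ∑ j ∈ range m, G (Z j ω)) atTop
      (𝓝 (∫ z, G z ∂Q)) := by
    rw [← (hZ 0).integral_comp hG.aestronglyMeasurable]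
    refine strong_law_ae (fun j => G ∘ Z j) ?_ (fun i j hij => (hindep hij).comp hG hG)
      fun j => ((hZ j).identDistrib (hZ 0)).comp hG
    exact ((hZ 0).map_eq ▸ hGint).comp_aemeasurable (hZ 0).aemeasurable
  refine ⟨continuousOn_iff_continuous_domRestrict.2 (hmean ▸ map_continuous _ :), ?_⟩
  filter_upwards [hlim, ae_all_iff.2 fun j => ((hZ j).ae_iff hS.mem).2 hQS] with ω hω hS
  rw [tendstoUniformlyOn_iff_tendstoUniformly_comp_coe]
  have hunif := ContinuousMap.tendsto_iff_tendstoUniformly.1 hω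
  rw [hmean] at hunif
  convert hunif using 3 with m t
  · simp [sampleMean, hGf (hS _)]
  · rfl

lemma tendsto_argmax {K : Set T} (hK : IsCompact K) {M : ℕ → T → ℝ} {L : T → ℝ}
    (hL : ContinuousOn L K) (hM : TendstoUniformlyOn M L atTop K) {t₀ : T} (ht₀ : t₀ ∈ K)
    (hmax : ∀ t ∈ K, t ≠ t₀ → L t < L t₀) {s : ℕ → T} (hsK : ∀ m, s m ∈ K)
    (hs : ∀ m, M m t₀ ≤ M m (s m)) : Tendsto s atTop (𝓝 t₀) := by
  rw [tendsto_nhds]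
  intro U hU hmem
  rcases (K \ U).eq_empty_or_nonempty with hempty | hne
  · exact Eventually.of_forall fun m => Set.sdiff_eq_empty.1 hempty (hsK m)
  obtain ⟨t₁, ht₁, ht₁max⟩ :=
    (hK.diff hU).exists_isMaxOn hne (hL.mono Set.sdiff_subset)
  have hlt : L t₁ < L t₀ := hmax t₁ ht₁.1 fun h => ht₁.2 (h ▸ hmem)
  filter_upwards [Metric.tendstoUniformlyOn_iff.1 hM _ (half_pos (sub_pos.2 hlt))] with m hm
  by_contra hout
  have hL₁ : L (s m) ≤ L t₁ := ht₁max ⟨hsK m, hout⟩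
  have hsm := hm (s m) (hsK m)
  have hm₀ := hm t₀ ht₀
  rw [dist_eq, abs_lt] at hsm hm₀
  linarith [hs m, hsm.1, hm₀.2]

end UniformLaw

section Quantile

variable (N : Measure ℝ) [IsProbabilityMeasure N] [NullSingletonClass N]

lemma continuous_cdf : Continuous (cdf N) := by
  refine continuous_iff_continuousAt.2 fun t => ?_
  rw [(cdf N).mono.continuousAt_iff_leftLim_eq_rightLim, StieltjesFunction.rightLim_eq]
  have hjump := (cdf N).measure_singleton t
  rw [measure_cdf, measure_singleton, eq_comm, ENNReal.ofReal_eq_zero] at hjump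
  exact le_antisymm ((cdf N).mono.leftLim_le le_rfl) (sub_nonpos.1 hjump)

lemma cdf_sInf_setOf_le {q : ℝ} (hq0 : 0 < q) (hq1 : q < 1) :
    cdf N (sInf {t | q ≤ cdf N t}) = q := by
  have hcont := continuous_cdf N
  obtain ⟨t₀, ht₀⟩ := ((tendsto_cdf_atBot N).eventually_lt_const hq0).exists
  obtain ⟨t₁, ht₁⟩ := ((tendsto_cdf_atTop N).eventually_const_lt hq1).exists
  have hbdd : BddBelow {t | q ≤ cdf N t} :=
    ⟨t₀, fun t ht => ((monotone_cdf N).reflect_lt (ht₀.trans_le ht)).le⟩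
  refine le_antisymm ?_ ((isClosed_le continuous_const hcont).csInf_mem ⟨t₁, ht₁.le⟩ hbdd)
  have hleft : Tendsto (cdf N) (𝓝[<] sInf {t | q ≤ cdf N t}) (𝓝 (cdf N (sInf {t | q ≤ cdf N t}))) :=
    hcont.continuousAt.mono_left nhdsWithin_le_nhds
  refine le_of_tendsto hleft ?_
  filter_upwards [self_mem_nhdsWithin] with t ht
  by_contra hlt
  exact (csInf_le hbdd (not_le.1 hlt).le).not_gt ht

lemma gaussianReal_Iic_neg (t : ℝ) :
    (gaussianReal 0 1).real (Set.Iic (-t)) = 1 - cdf (gaussianReal 0 1) t := by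
  have := nullSingletonClass_gaussianReal (μ := 0) (v := 1) one_ne_zero
  have hneg : (gaussianReal 0 1).map (fun t => -t) = gaussianReal 0 1 := by
    simpa using gaussianReal_map_neg (μ := 0) (v := 1)
  have hpre : (fun t : ℝ => -t) ⁻¹' Set.Iic (-t) = Set.Ici t := by ext; simp
  rw [← hneg, map_measureReal_apply measurable_neg measurableSet_Iic, hpre, hneg,
    measureReal_congr Ioi_ae_eq_Ici.symm, ← Set.compl_Iic,
    probReal_compl_eq_one_sub measurableSet_Iic, cdf_eq_real]

lemma gaussianReal_Ioo_upperQuantile {α : ℝ} (hα0 : 0 < α) (hα1 : α < 1) :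
    (gaussianReal 0 1).real (Set.Ioo (-upperQuantile (α / 2)) (upperQuantile (α / 2)))
      = 1 - α := by
  have := nullSingletonClass_gaussianReal (μ := 0) (v := 1) one_ne_zero
  set z := upperQuantile (α / 2)
  have hcdf : cdf (gaussianReal 0 1) z = 1 - α / 2 :=
    cdf_sInf_setOf_le (gaussianReal 0 1) (by linarith) (by linarith)
  have hle : -z ≤ z := by
    refine ((monotone_cdf (gaussianReal 0 1)).reflect_lt ?_).le
    rw [cdf_eq_real, gaussianReal_Iic_neg, hcdf]
    linarith
  have hdiff : Set.Ioc (-z) z = Set.Iic z \ Set.Iic (-z) := by ext; simp [and_comm]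
  rw [measureReal_congr Ioo_ae_eq_Ioc, hdiff,
    measureReal_sdiff (Set.Iic_subset_Iic.2 hle) measurableSet_Iic, gaussianReal_Iic_neg,
    ← cdf_eq_real, hcdf]
  ring

end Quantile

section QuadraticGrowth

section Continuity

variable {T : Type*} [TopologicalSpace T] {s : Set T} {μ v y : T → ℝ}

lemma continuousOn_varWeight (hv : ContinuousOn v s) (hpos : ∀ t ∈ s, 0 < v t) (γ : ℝ) :
    ContinuousOn (fun t => varWeight γ (v t)) s :=
  (hv.const_mul _).rpow_const fun t ht => .inl (mul_pos two_pi_pos (hpos t ht)).ne'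

lemma continuousOn_curvature (hμ : ContinuousOn μ s) (hv : ContinuousOn v s)
    (hy : ContinuousOn y s) (hpos : ∀ t ∈ s, 0 < v t) (k γ : ℝ) :
    ContinuousOn (fun t => curvature k γ (μ t) (v t) (y t)) s := by
  have hW := continuousOn_varWeight hv hpos γ
  have hinv : ContinuousOn (fun t => (v t)⁻¹) s := hv.inv₀ fun t ht => (hpos t ht).ne'
  simp only [curvature, div_eq_mul_inv, mul_inv]
  fun_prop

lemma continuousOn_genLogLik {c : ℝ → ℝ → ℝ → ℝ} {k : ℝ → ℝ} (hk : IsNormFactor c k)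
    (hμ : ContinuousOn μ s) (hv : ContinuousOn v s) (hy : ContinuousOn y s)
    (hpos : ∀ t ∈ s, 0 < v t) {γ : ℝ} (hγ : 0 ≤ γ) :
    ContinuousOn (fun t => genLogLik c γ (μ t) (v t) (y t)) s := by
  have hW := continuousOn_varWeight hv hpos γ
  have hinv : ContinuousOn (fun t => (v t)⁻¹) s := hv.inv₀ fun t ht => (hpos t ht).ne'
  rcases hγ.eq_or_lt with rfl | hγ
  · have hlog : ContinuousOn (fun t => log (2 * π * v t)) s :=
      (hv.const_mul _).log fun t ht => (mul_pos two_pi_pos (hpos t ht)).ne'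
    refine ContinuousOn.congr ?_ fun t ht => genLogLik_zero c (hpos t ht) _ _
    simp only [div_eq_mul_inv, mul_inv]
    fun_prop
  · refine ContinuousOn.congr ?_ fun t ht => genLogLik_of_pos hk hγ (hpos t ht) _ _
    simp only [div_eq_mul_inv, mul_inv]
    fun_prop

end Continuity

variable {c : ℝ → ℝ → ℝ → ℝ} {k : ℝ → ℝ}

lemma abs_curvature_le {γ v : ℝ} (hγ : 0 ≤ γ) (hv : 0 < v) (k μ y : ℝ) :
    |curvature k γ μ v y| ≤ 2 * |k| * varWeight γ v * v⁻¹ := by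
  have hW := varWeight_pos hv γ
  set u := γ * (y - μ) ^ 2 / (2 * v) with hu
  have hu0 : 0 ≤ u := by positivity
  have hfactor : |(1 - 2 * u) * exp (-u)| ≤ 2 := by
    rw [abs_mul, abs_of_pos (exp_pos _), exp_neg, ← div_eq_mul_inv, div_le_iff₀ (exp_pos _), abs_le]
    constructor <;> linarith [add_one_le_exp u]
  have hcurv : curvature k γ μ v y = k * varWeight γ v * v⁻¹ * ((1 - 2 * u) * exp (-u)) := by
    rw [curvature, hu]
    congr 3
    field_simp
  rw [hcurv, abs_mul, abs_mul, abs_mul, abs_of_pos hW, abs_of_pos (inv_pos.2 hv)]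
  calc |k| * varWeight γ v * v⁻¹ * |(1 - 2 * u) * exp (-u)|
      ≤ |k| * varWeight γ v * v⁻¹ * 2 := by gcongr
    _ = 2 * |k| * varWeight γ v * v⁻¹ := by ring

lemma integrable_curvature {γ v : ℝ} (hγ : 0 ≤ γ) (hv : 0 < v) (k μ : ℝ) {Q : Measure ℝ}
    [IsFiniteMeasure Q] : Integrable (fun y => curvature k γ μ v y) Q := by
  refine .of_bound ?_ _ (ae_of_all _ (abs_curvature_le hγ hv k μ))
  simp only [curvature]
  fun_prop

lemma abs_genLogLik_zero_le (c : ℝ → ℝ → ℝ → ℝ) {v : ℝ} (hv : 0 < v) (μ y : ℝ) :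
    |genLogLik c 0 μ v y| ≤ (|log (2 * π * v)| + (1 + μ ^ 2) / v) * (1 + y ^ 2) := by
  have hsq : (y - μ) ^ 2 / (2 * v) ≤ (1 + μ ^ 2) / v * (1 + y ^ 2) := by
    rw [div_mul_eq_mul_div, div_le_div_iff₀ (by positivity) hv]
    nlinarith [sq_nonneg (y + μ), mul_nonneg (sq_nonneg μ) (sq_nonneg y)]
  have hlog : |-(1 / 2) * log (2 * π * v)| ≤ |log (2 * π * v)| * (1 + y ^ 2) := by
    rw [abs_mul, abs_neg, abs_of_pos (by norm_num : (0 : ℝ) < 1 / 2)]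
    nlinarith [abs_nonneg (log (2 * π * v)),
      mul_nonneg (abs_nonneg (log (2 * π * v))) (sq_nonneg y)]
  calc |genLogLik c 0 μ v y|
      ≤ |-(1 / 2) * log (2 * π * v)| + |(y - μ) ^ 2 / (2 * v)| := by
        rw [genLogLik_zero c hv]; exact abs_sub _ _
    _ ≤ _ := by
        rw [abs_of_nonneg (by positivity : 0 ≤ (y - μ) ^ 2 / (2 * v)), add_mul]
        exact add_le_add hlog hsq

lemma abs_genLogLik_le_of_pos (hk : IsNormFactor c k) {γ v : ℝ} (hγ : 0 < γ) (hv : 0 < v)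
    (μ y : ℝ) : |genLogLik c γ μ v y| ≤ k γ / γ * varWeight γ v := by
  have hkγ := hk.pos γ hγ.le
  have hW := varWeight_pos hv γ
  rw [genLogLik_of_pos hk hγ hv, abs_of_nonneg (by positivity)]
  refine mul_le_of_le_one_right (by positivity) (exp_le_one_iff.2 ?_)
  rw [neg_nonpos]
  positivity

/-- `f t (y, w)` is jointly continuous for `(t, w) ∈ K × S` and grows at most quadratically in `y`,
uniformly over `K × S`. This makes the uniform law of large numbers applicable to `f`. -/
structure HasQuadraticGrowth {T W : Type*} [TopologicalSpace T] [TopologicalSpace W] (K : Set T)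
    (S : Set W) (f : T → ℝ × W → ℝ) : Prop where
  continuousOn : ContinuousOn (fun q : T × ℝ × W => f q.1 q.2) (K ×ˢ (Set.univ ×ˢ S))
  exists_bound : ∃ C, ∀ t ∈ K, ∀ w ∈ S, ∀ y, |f t (y, w)| ≤ C * (1 + y ^ 2)

lemma HasQuadraticGrowth.of_le {T W : Type*} [TopologicalSpace T] [TopologicalSpace W] {K : Set T}
    {S : Set W} (hK : IsCompact K) (hS : IsCompact S) {f : T → ℝ × W → ℝ}
    (hf : ContinuousOn (fun q : T × ℝ × W => f q.1 q.2) (K ×ˢ (Set.univ ×ˢ S))) {B : T × W → ℝ}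
    (hB : ContinuousOn B (K ×ˢ S))
    (hfB : ∀ t ∈ K, ∀ w ∈ S, ∀ y, |f t (y, w)| ≤ B (t, w) * (1 + y ^ 2)) :
    HasQuadraticGrowth K S f := by
  obtain ⟨C, hC⟩ := (hK.prod hS).exists_bound_of_continuousOn hB
  refine ⟨hf, C, fun t ht w hw y => (hfB t ht w hw y).trans ?_⟩
  gcongr
  exact (le_abs_self _).trans (hC (t, w) ⟨ht, hw⟩)

variable {p : ℕ} {Ψ : Set (Param p)} {S : Set (Cov p × ℝ)}

lemma hasQuadraticGrowth_areaLik (hk : IsNormFactor c k) {γ : ℝ} (hγ : 0 ≤ γ) (hΨ : IsCompact Ψ)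
    (hS : IsCompact S) (hpos : ∀ ψ ∈ Ψ, ∀ w ∈ S, 0 < ψ.2 + w.2) :
    HasQuadraticGrowth Ψ S fun ψ z => areaLik c γ ψ z.2.1 z.2.2 z.1 := by
  have hcont : ContinuousOn (fun q : Param p × ℝ × Cov p × ℝ =>
      areaLik c γ q.1 q.2.2.1 q.2.2.2 q.2.1) (Ψ ×ˢ (Set.univ ×ˢ S)) :=
    continuousOn_genLogLik hk (by fun_prop) (by fun_prop) (by fun_prop)
      (fun q hq => hpos q.1 hq.1 q.2.2 hq.2.2) hγ
  have hv : ∀ q ∈ Ψ ×ˢ S, 0 < q.1.2 + q.2.2 := fun q hq => hpos q.1 hq.1 q.2 hq.2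
  rcases hγ.eq_or_lt with rfl | hγ
  · have hlog : ContinuousOn (fun q : Param p × Cov p × ℝ => log (2 * π * (q.1.2 + q.2.2)))
        (Ψ ×ˢ S) :=
      ContinuousOn.log (by fun_prop) fun q hq => (mul_pos two_pi_pos (hv q hq)).ne'
    have hquot : ContinuousOn (fun q : Param p × Cov p × ℝ =>
        (1 + inner ℝ q.2.1 q.1.1 ^ 2) / (q.1.2 + q.2.2)) (Ψ ×ˢ S) :=
      ContinuousOn.div₀ (by fun_prop) (by fun_prop) fun q hq => (hv q hq).ne'
    exact .of_le hΨ hS hcont (hlog.abs.add hquot) fun ψ hψ w hw y =>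
      abs_genLogLik_zero_le c (hpos ψ hψ w hw) _ y
  · refine .of_le hΨ hS hcont ((continuousOn_varWeight (by fun_prop) hv γ).const_mul (k γ / γ))
      fun ψ hψ w hw y => ?_
    have hbound := abs_genLogLik_le_of_pos hk hγ (hpos ψ hψ w hw) (inner ℝ w.1 ψ.1) y
    exact hbound.trans (le_mul_of_one_le_right ((abs_nonneg _).trans hbound) (by nlinarith))

lemma hasQuadraticGrowth_postVar (hk : IsNormFactor c k) {γ : ℝ} (hγ : 0 ≤ γ) (hΨ : IsCompact Ψ)
    (hS : IsCompact S) (hpos : ∀ ψ ∈ Ψ, ∀ w ∈ S, 0 < ψ.2 + w.2) :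
    HasQuadraticGrowth Ψ S fun ψ z => postVar c γ ψ z.2.1 z.2.2 z.1 := by
  have hcurv : ContinuousOn (fun q : Param p × ℝ × Cov p × ℝ =>
      curvature (k γ) γ (inner ℝ q.2.2.1 q.1.1) (q.1.2 + q.2.2.2) q.2.1) (Ψ ×ˢ (Set.univ ×ˢ S)) :=
    continuousOn_curvature (by fun_prop) (by fun_prop) (by fun_prop)
      (fun q hq => hpos q.1 hq.1 q.2.2 hq.2.2) _ _
  have hcont : ContinuousOn (fun q : Param p × ℝ × Cov p × ℝ =>
      postVar c γ q.1 q.2.2.1 q.2.2.2 q.2.1) (Ψ ×ˢ (Set.univ ×ˢ S)) :=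
    (continuousOn_snd.snd.snd.sub ((continuousOn_snd.snd.snd.pow 2).mul hcurv)).congr fun q hq =>
      postVar_eq hk hγ (hpos q.1 hq.1 q.2.2 hq.2.2) _ _
  have hv : ∀ q ∈ Ψ ×ˢ S, 0 < q.1.2 + q.2.2 := fun q hq => hpos q.1 hq.1 q.2 hq.2
  have hW : ContinuousOn (fun q : Param p × Cov p × ℝ => varWeight γ (q.1.2 + q.2.2)) (Ψ ×ˢ S) :=
    continuousOn_varWeight (by fun_prop) hv γ
  have hinv : ContinuousOn (fun q : Param p × Cov p × ℝ => (q.1.2 + q.2.2)⁻¹) (Ψ ×ˢ S) :=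
    ContinuousOn.inv₀ (by fun_prop) fun q hq => (hv q hq).ne'
  have hd : ContinuousOn (fun q : Param p × Cov p × ℝ => q.2.2) (Ψ ×ˢ S) := by fun_prop
  refine .of_le hΨ hS hcont
    (hd.abs.add ((hd.pow 2).mul ((hW.const_mul (2 * |k γ|)).mul hinv))) fun ψ hψ w hw y => ?_
  have hbound : |postVar c γ ψ w.1 w.2 y|
      ≤ |w.2| + w.2 ^ 2 * (2 * |k γ| * varWeight γ (ψ.2 + w.2) * (ψ.2 + w.2)⁻¹) := by
    rw [postVar_eq hk hγ (hpos ψ hψ w hw)]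
    refine (abs_sub _ _).trans ?_
    rw [abs_mul, abs_of_nonneg (sq_nonneg w.2)]
    gcongr
    exact abs_curvature_le hγ (hpos ψ hψ w hw) _ _ _
  exact hbound.trans (le_mul_of_one_le_right ((abs_nonneg _).trans hbound) (by nlinarith))

end QuadraticGrowth

section PopulationLaw

variable {p : ℕ} {β : Cov p} {A : ℝ} {ν : Measure (Cov p × ℝ)} {S : Set (Cov p × ℝ)}

lemma integrable_marginalLaw_iff {f : ℝ × Cov p × ℝ → ℝ} :
    Integrable f (marginalLaw β A ν) ↔
      Integrable (fun q : (Cov p × ℝ) × ℝ => f (q.2, q.1)) (ν ⊗ₘ marginalKernel β A) :=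
  integrable_map_equiv MeasurableEquiv.prodComm f

variable [IsProbabilityMeasure ν]

instance (β : Cov p) (A : ℝ) : IsProbabilityMeasure (marginalLaw β A ν) :=
  Measure.isProbabilityMeasure_map measurable_swap.aemeasurable

lemma ae_marginalLaw_of_ae {q : Cov p × ℝ → Prop} (h : ∀ᵐ w ∂ν, q w) :
    ∀ᵐ z ∂marginalLaw β A ν, q z.2 := by
  have hsnd : (marginalLaw β A ν).map Prod.snd = ν := by
    rw [marginalLaw, Measure.map_map measurable_snd measurable_swap]
    exact Measure.fst_compProd ν _
  rw [← hsnd] at h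
  exact ae_of_ae_map measurable_snd.aemeasurable h

lemma integrable_integral_marginalKernel {f : ℝ × Cov p × ℝ → ℝ}
    (hf : Integrable f (marginalLaw β A ν)) :
    Integrable (fun w => ∫ y, f (y, w) ∂marginalKernel β A w) ν :=
  Integrable.integral_compProd (κ := Kernel.const Unit ν) (a := ())
    (η := Kernel.prodMkLeft Unit (marginalKernel β A)) (integrable_marginalLaw_iff.1 hf)

lemma integral_marginalLaw {f : ℝ × Cov p × ℝ → ℝ} (hf : Integrable f (marginalLaw β A ν)) :
    ∫ z, f z ∂marginalLaw β A ν = ∫ w, ∫ y, f (y, w) ∂marginalKernel β A w ∂ν :=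
  (integral_map_equiv MeasurableEquiv.prodComm f).trans
    (Measure.integral_compProd (integrable_marginalLaw_iff.1 hf))

lemma integral_marginalLaw_lt {f g : ℝ × Cov p × ℝ → ℝ} (hf : Integrable f (marginalLaw β A ν))
    (hg : Integrable g (marginalLaw β A ν))
    (hle : ∀ᵐ w ∂ν, ∫ y, f (y, w) ∂marginalKernel β A w ≤ ∫ y, g (y, w) ∂marginalKernel β A w)
    (hne : ¬ ∀ᵐ w ∂ν,
      ∫ y, f (y, w) ∂marginalKernel β A w = ∫ y, g (y, w) ∂marginalKernel β A w) :
    ∫ z, f z ∂marginalLaw β A ν < ∫ z, g z ∂marginalLaw β A ν := by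
  have hf' := integrable_integral_marginalKernel hf
  have hg' := integrable_integral_marginalKernel hg
  rw [integral_marginalLaw hf, integral_marginalLaw hg]
  exact (integral_mono_ae hf' hg' hle).lt_of_ne fun h =>
    hne ((integral_eq_iff_of_ae_le hf' hg' hle).1 h)

lemma integrable_sq_marginalLaw (hS : IsCompact S) (hνS : ∀ᵐ w ∂ν, w ∈ S) :
    Integrable (fun z => z.1 ^ 2) (marginalLaw β A ν) := by
  have hmoment (w : Cov p × ℝ) : ∫ y, ‖y ^ 2‖ ∂marginalKernel β A w
      = inner ℝ w.1 β ^ 2 + (A + w.2).toNNReal := by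
    change ∫ y, ‖y ^ 2‖ ∂gaussianReal _ _ = _
    simpa using integral_sub_sq_gaussianReal (inner ℝ w.1 β) (A + w.2).toNNReal 0
  refine integrable_marginalLaw_iff.2
    ((Measure.integrable_compProd_iff (by fun_prop)).2 ⟨ae_of_all _ fun w => ?_, ?_⟩)
  · change Integrable (fun y => y ^ 2) (gaussianReal _ _)
    simpa using integrable_sub_sq_gaussianReal (inner ℝ w.1 β) (A + w.2).toNNReal 0
  · simp only [hmoment]
    rw [← Measure.restrict_eq_self_of_ae_mem hνS]
    exact ContinuousOn.integrableOn_compact hS (by fun_prop)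

lemma HasQuadraticGrowth.integrable {T : Type*} [TopologicalSpace T] {K : Set T}
    {f : T → ℝ × Cov p × ℝ → ℝ} (hf : HasQuadraticGrowth K S f) (hS : IsCompact S)
    (hνS : ∀ᵐ w ∂ν, w ∈ S) {t : T} (ht : t ∈ K) : Integrable (f t) (marginalLaw β A ν) := by
  obtain ⟨C, hC⟩ := hf.exists_bound
  have hmem : ∀ᵐ z ∂marginalLaw β A ν, z.2 ∈ S := ae_marginalLaw_of_ae hνS
  have hmeas : AEStronglyMeasurable (f t) (marginalLaw β A ν) := by
    rw [← Measure.restrict_eq_self_of_ae_mem (s := Set.univ ×ˢ S)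
      (hmem.mono fun z hz => ⟨trivial, hz⟩)]
    exact (hf.continuousOn.comp (f := fun z => (t, z)) (by fun_prop)
      fun z hz => ⟨ht, hz⟩).aestronglyMeasurable (MeasurableSet.univ.prod hS.measurableSet)
  refine (((integrable_const 1).add (integrable_sq_marginalLaw hS hνS)).const_mul C).mono' hmeas ?_
  exact hmem.mono fun z hz => hC t ht z.2 hz z.1

lemma integral_postVar_marginalKernel_lt {c : ℝ → ℝ → ℝ → ℝ} {k : ℝ → ℝ} (hk : IsNormFactor c k)
    {γ : ℝ} (hγ : 0 < γ) {w : Cov p × ℝ} (hw : 0 < w.2)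
    (hv3 : (2 * π)⁻¹ * exp (-3) < A + w.2) :
    ∫ y, postVar c 0 (β, A) w.1 w.2 y ∂marginalKernel β A w
      < ∫ y, postVar c γ (β, A) w.1 w.2 y ∂marginalKernel β A w := by
  have hv : 0 < A + w.2 := hv3.trans' (by positivity)
  change ∫ y, _ ∂gaussianReal _ _ < ∫ y, _ ∂gaussianReal _ _
  simp only [postVar_eq hk le_rfl (show 0 < (β, A).2 + w.2 from hv), hk.zero, curvature_one_zero,
    postVar_eq hk hγ.le (show 0 < (β, A).2 + w.2 from hv)]
  rw [integral_const, probReal_univ, one_smul, integral_sub (integrable_const _)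
    ((integrable_curvature hγ.le hv _ _).const_mul _), integral_const_mul, integral_const,
    probReal_univ, one_smul]
  gcongr
  exact integral_curvature_lt (hk.pos γ hγ.le) (hk.le γ hγ) hγ hv3 _

end PopulationLaw

section Regularity

variable {Ω : Type*} [MeasurableSpace Ω] {P : Measure Ω} {p : ℕ}

lemma eq_zero_of_inner_ae_eq_zero {x : Ω → Cov p}
    (hint : ∀ j l, Integrable (fun ω => x ω j * x ω l) P)
    (hpd : (Matrix.of fun j l : Fin p => ∫ ω, x ω j * x ω l ∂P).PosDef) {u : Cov p}
    (hu : ∀ᵐ ω ∂P, inner ℝ (x ω) u = 0) : u = 0 := by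
  by_contra hne
  have hquad := hpd.dotProduct_mulVec_pos (x := u.ofLp) (by simpa using hne)
  refine hquad.ne' ?_
  have hmulVec : (Matrix.of fun j l : Fin p => ∫ ω, x ω j * x ω l ∂P).mulVec u.ofLp = 0 := by
    funext j
    calc ∑ l, (∫ ω, x ω j * x ω l ∂P) * u l
        = ∫ ω, ∑ l, x ω j * x ω l * u l ∂P := by
          simp_rw [← integral_mul_const]
          exact (integral_finsetSum _ fun l _ => (hint j l).mul_const _).symm
      _ = ∫ ω, x ω j * inner ℝ (x ω) u ∂P := by
          simp [PiLp.inner_apply, Finset.mul_sum, mul_comm, mul_left_comm]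
      _ = 0 := integral_eq_zero_of_ae (hu.mono fun ω hω => by simp [hω])
  rw [hmulVec, dotProduct_zero]

lemma integrable_mul_apply_of_norm_le [IsFiniteMeasure P] {x : Ω → Cov p} (hx : Measurable x)
    {B : ℝ} (hB : ∀ᵐ ω ∂P, ‖x ω‖ ≤ B) (j l : Fin p) :
    Integrable (fun ω => x ω j * x ω l) P := by
  refine .of_bound (by fun_prop) (B * B) (hB.mono fun ω hω => ?_)
  rw [norm_mul]
  exact mul_le_mul ((PiLp.norm_apply_le (x ω) j).trans hω) ((PiLp.norm_apply_le (x ω) l).trans hω)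
    (norm_nonneg _) ((norm_nonneg _).trans hω)

/-- The standing assumptions: `Ψ` is a compact parameter space containing the true parameter
`(β, A)`, the law `ν` of `(x, D)` is carried by a compact set `S`, and `β` is identifiable. -/
structure IsRegular (Ψ : Set (Param p)) (β : Cov p) (A : ℝ) (ν : Measure (Cov p × ℝ))
    (S : Set (Cov p × ℝ)) : Prop where
  isCompact_param : IsCompact Ψ
  param_pos : ∀ ψ ∈ Ψ, 0 < ψ.2
  true_mem : (β, A) ∈ Ψ
  isCompact_design : IsCompact S
  design_pos : ∀ w ∈ S, 0 < w.2
  ae_mem_design : ∀ᵐ w ∂ν, w ∈ S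
  identifiable : ∀ u : Cov p, (∀ᵐ w ∂ν, inner ℝ w.1 u = 0) → u = 0

lemma isRegular_map [IsFiniteMeasure P] {β : Cov p} {A DL DU : ℝ} {x : Ω → Cov p}
    {D : Ω → ℝ} {X : Set (Cov p)} {Ψ : Set (Param p)} (hx : Measurable x) (hD : Measurable D)
    (hDL : 0 < DL) (hDbd : ∀ᵐ ω ∂P, DL ≤ D ω ∧ D ω ≤ DU) (hX : Bornology.IsBounded X)
    (hxX : ∀ᵐ ω ∂P, x ω ∈ X) (hxpd : (Matrix.of fun j k : Fin p => ∫ ω, x ω j * x ω k ∂P).PosDef)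
    (hΨ : IsCompact Ψ) (hΨpos : ∀ ψ ∈ Ψ, 0 < ψ.2) (hmem : (β, A) ∈ Ψ) :
    IsRegular Ψ β A (P.map fun ω => (x ω, D ω)) (closure X ×ˢ Set.Icc DL DU) where
  isCompact_param := hΨ
  param_pos := hΨpos
  true_mem := hmem
  isCompact_design := hX.isCompact_closure.prod isCompact_Icc
  design_pos w hw := hDL.trans_le hw.2.1
  ae_mem_design := by
    refine (ae_map_iff (by fun_prop) (isClosed_closure.prod isClosed_Icc).measurableSet).2 ?_
    filter_upwards [hxX, hDbd] with ω hxω hDω using ⟨subset_closure hxω, hDω⟩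
  identifiable u hu := by
    obtain ⟨B, hB⟩ := hX.exists_norm_le
    exact eq_zero_of_inner_ae_eq_zero
      (integrable_mul_apply_of_norm_le hx (hxX.mono fun ω hω => hB _ hω)) hxpd
      (ae_of_ae_map (hx.prodMk hD).aemeasurable hu)

namespace IsRegular

variable {β : Cov p} {A : ℝ} {ν : Measure (Cov p × ℝ)} {S : Set (Cov p × ℝ)} {Ψ : Set (Param p)}
  {c : ℝ → ℝ → ℝ → ℝ} {k : ℝ → ℝ} {γ : ℝ}

lemma hasQuadraticGrowth_areaLik (h : IsRegular Ψ β A ν S) (hk : IsNormFactor c k) (hγ : 0 ≤ γ) :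
    HasQuadraticGrowth Ψ S fun ψ z => areaLik c γ ψ z.2.1 z.2.2 z.1 :=
  FayHerriot.hasQuadraticGrowth_areaLik hk hγ h.isCompact_param h.isCompact_design
    fun ψ hψ w hw => add_pos (h.param_pos ψ hψ) (h.design_pos w hw)

lemma hasQuadraticGrowth_postVar (h : IsRegular Ψ β A ν S) (hk : IsNormFactor c k) (hγ : 0 ≤ γ) :
    HasQuadraticGrowth Ψ S fun ψ z => postVar c γ ψ z.2.1 z.2.2 z.1 :=
  FayHerriot.hasQuadraticGrowth_postVar hk hγ h.isCompact_param h.isCompact_design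
    fun ψ hψ w hw => add_pos (h.param_pos ψ hψ) (h.design_pos w hw)

variable [IsProbabilityMeasure ν]

lemma integral_areaLik_lt (h : IsRegular Ψ β A ν S) (hk : IsNormFactor c k) (hγ : 0 ≤ γ)
    {ψ : Param p} (hψ : ψ ∈ Ψ) (hne : ψ ≠ (β, A)) :
    ∫ z, areaLik c γ ψ z.2.1 z.2.2 z.1 ∂marginalLaw β A ν
      < ∫ z, areaLik c γ (β, A) z.2.1 z.2.2 z.1 ∂marginalLaw β A ν := by
  have hgrowth := h.hasQuadraticGrowth_areaLik hk hγ
  have hint {ψ : Param p} (hψ : ψ ∈ Ψ) :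
      Integrable (fun z => areaLik c γ ψ z.2.1 z.2.2 z.1) (marginalLaw β A ν) :=
    hgrowth.integrable h.isCompact_design h.ae_mem_design hψ
  have hlt : ∀ᵐ w ∂ν, (inner ℝ w.1 ψ.1, ψ.2 + w.2) ≠ (inner ℝ w.1 β, A + w.2) →
      ∫ y, areaLik c γ ψ w.1 w.2 y ∂marginalKernel β A w
        < ∫ y, areaLik c γ (β, A) w.1 w.2 y ∂marginalKernel β A w := by
    filter_upwards [h.ae_mem_design] with w hw hw'
    exact integral_genLogLik_lt hk hγ (add_pos (h.param_pos _ hψ) (h.design_pos w hw))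
      (add_pos (h.param_pos _ h.true_mem) (h.design_pos w hw)) hw'
  refine integral_marginalLaw_lt (hint hψ) (hint h.true_mem) ?_ fun heq => hne ?_
  · filter_upwards [hlt] with w hw
    by_cases hpar : (inner ℝ w.1 ψ.1, ψ.2 + w.2) = (inner ℝ w.1 β, A + w.2)
    · simp only [areaLik, Prod.mk.inj hpar, le_refl]
    · exact (hw hpar).le
  · have hpar : ∀ᵐ w ∂ν, inner ℝ w.1 ψ.1 = inner ℝ w.1 β ∧ ψ.2 + w.2 = A + w.2 := by
      filter_upwards [heq, hlt] with w hw hw'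
      by_contra hpar
      exact (hw' fun h => hpar (Prod.mk.inj h)).ne hw
    obtain ⟨w, hw⟩ := hpar.exists
    have hβ := h.identifiable (ψ.1 - β) (hpar.mono fun w hw => by
      rw [inner_sub_right, hw.1, sub_self])
    exact Prod.ext (sub_eq_zero.1 hβ) (add_right_cancel hw.2)

lemma integral_postVar_lt (h : IsRegular Ψ β A ν S) (hk : IsNormFactor c k) (hγ : 0 < γ)
    (hv3 : ∀ w ∈ S, (2 * π)⁻¹ * exp (-3) < A + w.2) :
    ∫ z, postVar c 0 (β, A) z.2.1 z.2.2 z.1 ∂marginalLaw β A ν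
      < ∫ z, postVar c γ (β, A) z.2.1 z.2.2 z.1 ∂marginalLaw β A ν := by
  have hint {γ : ℝ} (hγ : 0 ≤ γ) :
      Integrable (fun z => postVar c γ (β, A) z.2.1 z.2.2 z.1) (marginalLaw β A ν) :=
    (h.hasQuadraticGrowth_postVar hk hγ).integrable h.isCompact_design h.ae_mem_design h.true_mem
  have hlt : ∀ᵐ w ∂ν, ∫ y, postVar c 0 (β, A) w.1 w.2 y ∂marginalKernel β A w
      < ∫ y, postVar c γ (β, A) w.1 w.2 y ∂marginalKernel β A w := by
    filter_upwards [h.ae_mem_design] with w hw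
    exact integral_postVar_marginalKernel_lt hk hγ (h.design_pos w hw) (hv3 w hw)
  refine integral_marginalLaw_lt (hint le_rfl) (hint hγ.le) (hlt.mono fun w hw => hw.le)
    fun heq => ?_
  obtain ⟨w, hw, hw'⟩ := (heq.and hlt).exists
  exact hw'.ne hw

end IsRegular

end Regularity

section Consistency

variable {Ω : Type*} [MeasurableSpace Ω] {P : Measure Ω} {p : ℕ} {β : Cov p} {A : ℝ}
  {ν : Measure (Cov p × ℝ)} [IsProbabilityMeasure ν] {S : Set (Cov p × ℝ)}

lemma eventually_eq_argmin {ι : Type*} {Γ : Finset ι} {M : ℕ → ι → ℝ} {L : ι → ℝ}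
    (hM : ∀ γ ∈ Γ, Tendsto (fun m => M m γ) atTop (𝓝 (L γ))) {γ₀ : ι} (hγ₀ : γ₀ ∈ Γ)
    (hmin : ∀ γ ∈ Γ, γ ≠ γ₀ → L γ₀ < L γ) {s : ℕ → ι} (hsΓ : ∀ m, s m ∈ Γ)
    (hs : ∀ m, M m (s m) ≤ M m γ₀) : ∀ᶠ m in atTop, s m = γ₀ := by
  have hlt : ∀ᶠ m in atTop, ∀ γ ∈ Γ, γ ≠ γ₀ → M m γ₀ < M m γ :=
    Γ.eventually_all.2 fun γ hγ => eventually_imp_distrib_left.2 fun hne =>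
      (hM γ₀ hγ₀).eventually_lt (hM γ hγ) (hmin γ hγ hne)
  filter_upwards [hlt] with m hm
  by_contra hne
  exact (hm _ (hsΓ m) hne).not_ge (hs m)

lemma HasQuadraticGrowth.tendstoUniformlyOn_sampleMean {T : Type*} [TopologicalSpace T] [T2Space T]
    [SecondCountableTopology T] {K : Set T} {f : T → ℝ × Cov p × ℝ → ℝ}
    (hf : HasQuadraticGrowth K S f) (hK : IsCompact K) (hS : IsCompact S) (hνS : ∀ᵐ w ∂ν, w ∈ S)
    {Z : ℕ → Ω → ℝ × Cov p × ℝ} (hZ : ∀ j, HasLaw (Z j) (marginalLaw β A ν) P)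
    (hindep : Pairwise fun i j => IndepFun (Z i) (Z j) P) :
    ContinuousOn (fun t => ∫ z, f t z ∂marginalLaw β A ν) K ∧
    ∀ᵐ ω ∂P, TendstoUniformlyOn (fun m t => sampleMean (f t) (fun j => Z j ω) m)
      (fun t => ∫ z, f t z ∂marginalLaw β A ν) atTop K := by
  obtain ⟨C, hC⟩ := hf.exists_bound
  exact FayHerriot.tendstoUniformlyOn_sampleMean hK (MeasurableSet.univ.prod hS.measurableSet)
    ((ae_marginalLaw_of_ae hνS).mono fun z hz => ⟨trivial, hz⟩) hf.continuousOn
    (((integrable_const 1).add (integrable_sq_marginalLaw hS hνS)).const_mul C)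
    (fun t ht z hz => hC t ht z.2 hz.2 z.1) hZ hindep

namespace IsRegular

variable {Ψ : Set (Param p)} {c : ℝ → ℝ → ℝ → ℝ} {k : ℝ → ℝ} {γ : ℝ} {x : ℕ → Ω → Cov p}
  {D y : ℕ → Ω → ℝ}

lemma tendsto_gammaEstimate (h : IsRegular Ψ β A ν S) (hk : IsNormFactor c k) (hγ : 0 ≤ γ)
    (hlaw : ∀ j, HasLaw (fun ω => (y j ω, x j ω, D j ω)) (marginalLaw β A ν) P)
    (hindep : Pairwise fun i j =>
      IndepFun (fun ω => (y i ω, x i ω, D i ω)) (fun ω => (y j ω, x j ω, D j ω)) P)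
    {ψhat : ℕ → Ω → Param p} (hψ : ∀ m, ∀ᵐ ω ∂P, IsGammaEstimate c Ψ γ m
      (fun j => x j ω) (fun j => D j ω) (fun j => y j ω) (ψhat m ω)) :
    ∀ᵐ ω ∂P, Tendsto (fun m => ψhat m ω) atTop (𝓝 (β, A)) := by
  obtain ⟨hcont, hunif⟩ := (h.hasQuadraticGrowth_areaLik hk hγ).tendstoUniformlyOn_sampleMean
    h.isCompact_param h.isCompact_design h.ae_mem_design hlaw hindep
  filter_upwards [hunif, ae_all_iff.2 hψ] with ω hunif hψ
  exact tendsto_argmax h.isCompact_param hcont hunif h.true_mem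
    (fun ψ hψ hne => h.integral_areaLik_lt hk hγ hψ hne) (fun m => (hψ m).1)
    fun m => mul_le_mul_of_nonneg_left ((hψ m).2 _ h.true_mem) (by positivity)

lemma tendsto_sampleMean_postVar (h : IsRegular Ψ β A ν S) (hk : IsNormFactor c k) (hγ : 0 ≤ γ)
    (hlaw : ∀ j, HasLaw (fun ω => (y j ω, x j ω, D j ω)) (marginalLaw β A ν) P)
    (hindep : Pairwise fun i j =>
      IndepFun (fun ω => (y i ω, x i ω, D i ω)) (fun ω => (y j ω, x j ω, D j ω)) P)
    {ψhat : ℕ → Ω → Param p} (hψ : ∀ m, ∀ᵐ ω ∂P, IsGammaEstimate c Ψ γ m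
      (fun j => x j ω) (fun j => D j ω) (fun j => y j ω) (ψhat m ω)) :
    ∀ᵐ ω ∂P, Tendsto (fun m => sampleMean (fun z => postVar c γ (ψhat m ω) z.2.1 z.2.2 z.1)
        (fun j => (y j ω, x j ω, D j ω)) m) atTop
      (𝓝 (∫ z, postVar c γ (β, A) z.2.1 z.2.2 z.1 ∂marginalLaw β A ν)) := by
  obtain ⟨hcont, hunif⟩ := (h.hasQuadraticGrowth_postVar hk hγ).tendstoUniformlyOn_sampleMean
    h.isCompact_param h.isCompact_design h.ae_mem_design hlaw hindep
  filter_upwards [hunif, ae_all_iff.2 hψ, h.tendsto_gammaEstimate hk hγ hlaw hindep hψ]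
    with ω hunif hψ hlim
  exact hunif.tendsto_comp (hcont _ h.true_mem) (tendsto_nhdsWithin_iff.2
    ⟨hlim, .of_forall fun m => (hψ m).1⟩)

lemma eventually_optimalGamma_eq_zero (h : IsRegular Ψ β A ν S) (hk : IsNormFactor c k)
    (hv3 : ∀ w ∈ S, (2 * π)⁻¹ * exp (-3) < A + w.2)
    (hlaw : ∀ j, HasLaw (fun ω => (y j ω, x j ω, D j ω)) (marginalLaw β A ν) P)
    (hindep : Pairwise fun i j =>
      IndepFun (fun ω => (y i ω, x i ω, D i ω)) (fun ω => (y j ω, x j ω, D j ω)) P)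
    {Γ : Finset ℝ} (hΓ0 : (0 : ℝ) ∈ Γ) (hΓ : ∀ γ ∈ Γ, 0 ≤ γ) {ψhat : ℝ → ℕ → Ω → Param p}
    (hψ : ∀ γ ∈ Γ, ∀ m, ∀ᵐ ω ∂P, IsGammaEstimate c Ψ γ m
      (fun j => x j ω) (fun j => D j ω) (fun j => y j ω) (ψhat γ m ω)) {γop : ℕ → Ω → ℝ}
    (hγop : ∀ m, ∀ᵐ ω ∂P, IsOptimalGamma c Γ m (fun γ => ψhat γ m ω)
      (fun j => x j ω) (fun j => D j ω) (fun j => y j ω) (γop m ω)) :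
    ∀ᵐ ω ∂P, ∀ᶠ m in atTop, γop m ω = 0 := by
  have hlim : ∀ᵐ ω ∂P, ∀ γ ∈ Γ, Tendsto (fun m => sampleMean
      (fun z => postVar c γ (ψhat γ m ω) z.2.1 z.2.2 z.1) (fun j => (y j ω, x j ω, D j ω)) m) atTop
      (𝓝 (∫ z, postVar c γ (β, A) z.2.1 z.2.2 z.1 ∂marginalLaw β A ν)) :=
    (ae_ball_iff Γ.countable_toSet).2 fun γ hγ =>
      h.tendsto_sampleMean_postVar hk (hΓ γ hγ) hlaw hindep (hψ γ hγ)
  filter_upwards [hlim, ae_all_iff.2 hγop] with ω hlim hopt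
  exact eventually_eq_argmin hlim hΓ0
    (fun γ hγ hne => h.integral_postVar_lt hk ((hΓ γ hγ).lt_of_ne' hne) hv3)
    (fun m => (hopt m).1) fun m => mul_le_mul_of_nonneg_left ((hopt m).2 0 hΓ0) (by positivity)

end IsRegular

end Consistency

section Intervals

lemma tendsto_mem_Ioo_iff {f g : ℕ → ℝ} {a b t : ℝ} (hf : Tendsto f atTop (𝓝 a))
    (hg : Tendsto g atTop (𝓝 b)) (ha : t ≠ a) (hb : t ≠ b) :
    ∀ᶠ m in atTop, (t ∈ Set.Ioo (f m) (g m) ↔ t ∈ Set.Ioo a b) := by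
  have hleft : ∀ᶠ m in atTop, (f m < t ↔ a < t) := by
    rcases ha.lt_or_gt with hlt | hgt
    · filter_upwards [hf.eventually_const_lt hlt] with m hm using iff_of_false hm.not_gt hlt.not_gt
    · filter_upwards [hf.eventually_lt_const hgt] with m hm using iff_of_true hm hgt
  have hright : ∀ᶠ m in atTop, (t < g m ↔ t < b) := by
    rcases hb.lt_or_gt with hlt | hgt
    · filter_upwards [hg.eventually_const_lt hlt] with m hm using iff_of_true hm hlt
    · filter_upwards [hg.eventually_lt_const hgt] with m hm using iff_of_false hm.not_gt hgt.not_gt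
  filter_upwards [hleft, hright] with m hleft hright using and_congr hleft hright

variable {p : ℕ}

lemma continuousAt_posteriorMean {ψ : Param p} {d : ℝ} (hv : ψ.2 + d ≠ 0) (x : Cov p) (y : ℝ) :
    ContinuousAt (fun ψ => posteriorMean ψ x d y) ψ := by
  unfold posteriorMean
  exact ContinuousAt.div (by fun_prop) (by fun_prop) hv

lemma continuousAt_posteriorVar {ψ : Param p} {d : ℝ} (hv : ψ.2 + d ≠ 0) :
    ContinuousAt (fun ψ : Param p => posteriorVar ψ d) ψ := by
  unfold posteriorVar
  exact ContinuousAt.div (by fun_prop) (by fun_prop) hv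

lemma mem_credibleInterval_iff {z d t y : ℝ} {ψ : Param p} {x : Cov p}
    (hs : 0 < posteriorVar ψ d) :
    t ∈ credibleInterval z ψ x d y ↔
      (t - posteriorMean ψ x d y) / √(posteriorVar ψ d) ∈ Set.Ioo (-z) z := by
  simp only [credibleInterval, Set.mem_Ioo, lt_div_iff₀ (sqrt_pos.2 hs),
    div_lt_iff₀ (sqrt_pos.2 hs)]
  constructor <;> rintro ⟨hlow, hup⟩ <;> constructor <;> linarith

lemma eventually_mem_credibleInterval_iff {z d t y : ℝ} {x : Cov p} {ψ₀ : Param p}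
    {ψ : ℕ → Param p} (hψ : Tendsto ψ atTop (𝓝 ψ₀)) (hv : ψ₀.2 + d ≠ 0)
    (hs : 0 < posteriorVar ψ₀ d)
    (hlow : (t - posteriorMean ψ₀ x d y) / √(posteriorVar ψ₀ d) ≠ -z)
    (hup : (t - posteriorMean ψ₀ x d y) / √(posteriorVar ψ₀ d) ≠ z) :
    ∀ᶠ m in atTop, (t ∈ credibleInterval z (ψ m) x d y ↔ t ∈ credibleInterval z ψ₀ x d y) := by
  have hmean := (continuousAt_posteriorMean hv x y).tendsto.comp hψ
  have hsd := (continuousAt_posteriorVar hv).tendsto.comp hψ |>.sqrt.const_mul z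
  have hs' := (sqrt_pos.2 hs).ne'
  refine tendsto_mem_Ioo_iff (hmean.sub hsd) (hmean.add hsd) (fun heq => hlow ?_)
    (fun heq => hup ?_) <;> rw [div_eq_iff hs'] <;> linarith

variable {Ω : Type*} [MeasurableSpace Ω] {P : Measure Ω} [IsProbabilityMeasure P]
  {β : Cov p} {A : ℝ} {x : Ω → Cov p} {D θ y : Ω → ℝ}

lemma IsModel.measureReal_credibleInterval (h : IsModel P β A x D θ y) (hA : 0 < A)
    (hx : Measurable x) (hD : Measurable D) (hθ : Measurable θ) (hy : Measurable y)
    (hDpos : ∀ᵐ ω ∂P, 0 < D ω) {α : ℝ} (hα0 : 0 < α) (hα1 : α < 1) :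
    P.real {ω | θ ω ∈ credibleInterval (upperQuantile (α / 2)) (β, A) (x ω) (D ω) (y ω)}
      = 1 - α := by
  rw [← gaussianReal_Ioo_upperQuantile hα0 hα1]
  refine Eq.trans (measureReal_congr ?_)
    ((h.hasLaw_pivot hA hx hD hθ hy hDpos).measureReal_eq measurableSet_Ioo)
  filter_upwards [hDpos] with ω hω
  exact propext (mem_credibleInterval_iff (div_pos (mul_pos hA hω) (add_pos hA hω)))

lemma measurableSet_mem_credibleInterval {ψ : Ω → Param p} (hψ : Measurable ψ) (hx : Measurable x)
    (hD : Measurable D) (hθ : Measurable θ) (hy : Measurable y) (z : ℝ) :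
    MeasurableSet {ω | θ ω ∈ credibleInterval z (ψ ω) (x ω) (D ω) (y ω)} := by
  unfold credibleInterval posteriorMean posteriorVar
  exact (measurableSet_lt (by fun_prop) hθ).inter (measurableSet_lt hθ (by fun_prop))

lemma IsModel.tendsto_measureReal_credibleInterval (h : IsModel P β A x D θ y) (hA : 0 < A)
    (hx : Measurable x) (hD : Measurable D) (hθ : Measurable θ) (hy : Measurable y)
    (hDpos : ∀ᵐ ω ∂P, 0 < D ω) {ψ : ℕ → Ω → Param p} (hψm : ∀ m, Measurable (ψ m))
    (hψ : ∀ᵐ ω ∂P, Tendsto (fun m => ψ m ω) atTop (𝓝 (β, A))) (z : ℝ) :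
    Tendsto (fun m => P.real {ω | θ ω ∈ credibleInterval z (ψ m ω) (x ω) (D ω) (y ω)}) atTop
      (𝓝 (P.real {ω | θ ω ∈ credibleInterval z (β, A) (x ω) (D ω) (y ω)})) := by
  have := nullSingletonClass_gaussianReal (μ := 0) (v := 1) one_ne_zero
  have hpivot (r : ℝ) : ∀ᵐ ω ∂P,
      (θ ω - posteriorMean (β, A) (x ω) (D ω) (y ω)) / √(posteriorVar (β, A) (D ω)) ≠ r :=
    ((h.hasLaw_pivot hA hx hD hθ hy hDpos).ae_iff (measurableSet_singleton r).compl.mem).2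
      (by simp [ae_iff])
  refine (ENNReal.tendsto_toReal (measure_ne_top _ _)).comp ?_
  refine tendsto_measure_of_ae_tendsto_indicator atTop
    (measurableSet_mem_credibleInterval measurable_const hx hD hθ hy z)
    (fun m => measurableSet_mem_credibleInterval (hψm m) hx hD hθ hy z) MeasurableSet.univ
    (measure_ne_top _ _) (.of_forall fun _ => Set.subset_univ _) ?_
  filter_upwards [hψ, hDpos, hpivot (-z), hpivot z] with ω hψ hd hlow hup
  exact eventually_mem_credibleInterval_iff hψ (add_pos hA hd).ne'
    (div_pos (mul_pos hA hd) (add_pos hA hd)) hlow hup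

end Intervals

section Convergence

variable {Ω : Type*} [MeasurableSpace Ω] {P : Measure Ω} [IsFiniteMeasure P]

lemma tendsto_measureReal_compl_of_ae_eventually_mem {G : ℕ → Set Ω}
    (hG : ∀ m, MeasurableSet (G m)) (hev : ∀ᵐ ω ∂P, ∀ᶠ m in atTop, ω ∈ G m) :
    Tendsto (fun m => P.real (G m)ᶜ) atTop (𝓝 0) := by
  have hlim : Tendsto (fun m => P (G m)ᶜ) atTop (𝓝 (P ∅)) := by
    refine tendsto_measure_of_ae_tendsto_indicator atTop .empty (fun m => (hG m).compl) .univ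
      (measure_ne_top _ _) (.of_forall fun _ => Set.subset_univ _) ?_
    filter_upwards [hev] with ω hω using hω.mono fun m hm => by simp [hm]
  rw [measure_empty] at hlim
  exact (ENNReal.tendsto_toReal ENNReal.zero_ne_top).comp hlim

lemma abs_measureReal_sub_le_of_agree {E E' G : Set Ω}
    (h : ∀ᵐ ω ∂P, ω ∈ G → (ω ∈ E ↔ ω ∈ E')) : |P.real E - P.real E'| ≤ P.real Gᶜ := by
  have hle {S T : Set Ω} (hST : ∀ᵐ ω ∂P, ω ∈ G → ω ∈ S → ω ∈ T) :
      P.real S ≤ P.real T + P.real Gᶜ := by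
    refine le_trans (ENNReal.toReal_mono (measure_ne_top _ _) (measure_mono_ae ?_))
      (measureReal_union_le T Gᶜ)
    filter_upwards [hST] with ω hω hS
    exact or_iff_not_imp_right.2 fun hG => hω (not_not.1 hG) hS
  have hEE' := hle (h.mono fun ω hω hG => (hω hG).1)
  have hE'E := hle (h.mono fun ω hω hG => (hω hG).2)
  exact abs_sub_le_iff.2 ⟨by linarith, by linarith⟩

lemma tendsto_measureReal_of_eventually_agree {E E' G : ℕ → Set Ω} {l : ℝ}
    (hE' : Tendsto (fun m => P.real (E' m)) atTop (𝓝 l)) (hG : ∀ m, MeasurableSet (G m))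
    (hev : ∀ᵐ ω ∂P, ∀ᶠ m in atTop, ω ∈ G m)
    (hagree : ∀ m, ∀ᵐ ω ∂P, ω ∈ G m → (ω ∈ E m ↔ ω ∈ E' m)) :
    Tendsto (fun m => P.real (E m)) atTop (𝓝 l) := by
  have hdiff : Tendsto (fun m => P.real (E m) - P.real (E' m)) atTop (𝓝 0) :=
    squeeze_zero_norm (fun m => abs_measureReal_sub_le_of_agree (hagree m))
      (tendsto_measureReal_compl_of_ae_eventually_mem hG hev)
  simpa using hdiff.add hE'

end Convergence

end FayHerriot

theorem theorem2_general {Ω : Type*} [MeasurableSpace Ω] {P : Measure Ω} [IsProbabilityMeasure P]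
    {p : ℕ} {x : ℕ → Ω → FayHerriot.Cov p} {D y : ℕ → Ω → ℝ} {θ : Ω → ℝ} {i : ℕ}
    (hx : Measurable (x i)) (hD : Measurable (D i)) (hθ : Measurable θ) (hy : Measurable (y i))
    {β : FayHerriot.Cov p} {A : ℝ} (hmodel : FayHerriot.IsModel P β A (x i) (D i) θ (y i))
    (hindep : Pairwise fun j l =>
      IndepFun (fun ω => (y j ω, x j ω, D j ω)) (fun ω => (y l ω, x l ω, D l ω)) P)
    (hident : ∀ j, IdentDistrib (fun ω => (y j ω, x j ω, D j ω))
      (fun ω => (y i ω, x i ω, D i ω)) P P)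
    {DL DU : ℝ} (hDL : 0 < DL) (hDbd : ∀ᵐ ω ∂P, DL ≤ D i ω ∧ D i ω ≤ DU)
    {X : Set (FayHerriot.Cov p)} (hX : Bornology.IsBounded X) (hxX : ∀ᵐ ω ∂P, x i ω ∈ X)
    (hxpd : (Matrix.of fun j k : Fin p => ∫ ω, x i ω j * x i ω k ∂P).PosDef)
    {Ψ : Set (FayHerriot.Param p)} (hΨ : IsCompact Ψ) (hΨpos : ∀ ψ ∈ Ψ, 0 < ψ.2)
    (hmem : (β, A) ∈ Ψ) (hA : (2 * Real.pi)⁻¹ * Real.exp (-3) < A + DL)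
    {c : ℝ → ℝ → ℝ → ℝ} {k : ℝ → ℝ} (hk : FayHerriot.IsNormFactor c k)
    {Γ : Finset ℝ} (hΓ0 : (0 : ℝ) ∈ Γ) (hΓ : ∀ γ ∈ Γ, 0 ≤ γ)
    {ψhat : ℝ → ℕ → Ω → FayHerriot.Param p} (hψm : ∀ m, Measurable (ψhat 0 m))
    (hψ : ∀ γ ∈ Γ, ∀ m, ∀ᵐ ω ∂P, FayHerriot.IsGammaEstimate c Ψ γ m
      (fun j => x j ω) (fun j => D j ω) (fun j => y j ω) (ψhat γ m ω))
    {γop : ℕ → Ω → ℝ} (hγm : ∀ m, Measurable (γop m))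
    (hγ : ∀ m, ∀ᵐ ω ∂P, FayHerriot.IsOptimalGamma c Γ m (fun γ => ψhat γ m ω)
      (fun j => x j ω) (fun j => D j ω) (fun j => y j ω) (γop m ω))
    {α : ℝ} (hα0 : 0 < α) (hα1 : α < 1) :
    Tendsto (fun m : ℕ => P.real {ω | θ ω ∈ FayHerriot.robustInterval c α (γop m ω)
      (ψhat (γop m ω) m ω) (x i ω) (D i ω) (y i ω)}) atTop (𝓝 (1 - α)) := by
  have hApos : 0 < A := hΨpos _ hmem
  have hDpos : ∀ᵐ ω ∂P, 0 < D i ω := hDbd.mono fun ω hω => hDL.trans_le hω.1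
  have : IsProbabilityMeasure (P.map fun ω => (x i ω, D i ω)) :=
    Measure.isProbabilityMeasure_map (hx.prodMk hD).aemeasurable
  have hreg := FayHerriot.isRegular_map hx hD hDL hDbd hX hxX hxpd hΨ hΨpos hmem
  have hlaw := fun j => (hident j).symm.hasLaw (hmodel.hasLaw_obs hApos hx hD hθ hy hDpos)
  have hselect := hreg.eventually_optimalGamma_eq_zero hk
    (fun w hw => hA.trans_le (add_le_add_right hw.2.1 A)) hlaw hindep hΓ0 hΓ hψ hγ
  have hconsistent := hreg.tendsto_gammaEstimate hk le_rfl hlaw hindep (hψ 0 hΓ0)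
  have hcover := hmodel.tendsto_measureReal_credibleInterval hApos hx hD hθ hy hDpos hψm
    hconsistent (FayHerriot.upperQuantile (α / 2))
  rw [hmodel.measureReal_credibleInterval hApos hx hD hθ hy hDpos hα0 hα1] at hcover
  refine FayHerriot.tendsto_measureReal_of_eventually_agree hcover
    (G := fun m => {ω | γop m ω = 0}) (fun m => hγm m (measurableSet_singleton 0)) hselect
    fun m => ?_
  filter_upwards [hψ 0 hΓ0 m, hDpos] with ω hω hd (hzero : γop m ω = 0)
  simp only [hzero, FayHerriot.robustInterval_zero hk (add_pos (hΨpos _ hω.1) hd)]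

theorem theorem2 {Ω : Type*} [MeasurableSpace Ω] (P : Measure Ω) [IsProbabilityMeasure P]
    {p : ℕ} (x : ℕ → Ω → FayHerriot.Cov p) (D θ y : ℕ → Ω → ℝ)
    (hx : ∀ i, Measurable (x i)) (hD : ∀ i, Measurable (D i))
    (hθ : ∀ i, Measurable (θ i)) (hy : ∀ i, Measurable (y i))
    -- the correctly specified model with true parameter `(β, A)`
    (β : FayHerriot.Cov p) (A : ℝ)
    (hmodel : ∀ i, FayHerriot.IsModel P β A (x i) (D i) (θ i) (y i))
    -- i.i.d. data and bounded sampling variances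
    (hindep : iIndepFun (fun i ω => (y i ω, x i ω, D i ω)) P)
    (hident : ∀ i, IdentDistrib (fun ω => (y i ω, x i ω, D i ω))
      (fun ω => (y 0 ω, x 0 ω, D 0 ω)) P P)
    (DL DU : ℝ) (hDL : 0 < DL) (hDbd : ∀ i, ∀ᵐ ω ∂P, DL ≤ D i ω ∧ D i ω ≤ DU)
    -- bounded covariates with positive definite second moment matrix
    (X : Set (FayHerriot.Cov p)) (hX : Bornology.IsBounded X) (hxX : ∀ i, ∀ᵐ ω ∂P, x i ω ∈ X)
    (hxpd : ∀ i, (Matrix.of fun j k : Fin p => ∫ ω, x i ω j * x i ω k ∂P).PosDef)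
    -- compact parameter space containing the true parameter
    (Ψ : Set (FayHerriot.Param p)) (hΨ : IsCompact Ψ) (hΨpos : ∀ ψ ∈ Ψ, 0 < ψ.2)
    (hmem : (β, A) ∈ Ψ) (hA : (2 * Real.pi)⁻¹ * Real.exp (-3) < A + DL)
    -- normalising factor of the divergence: integral form or closed form
    (c : ℝ → ℝ → ℝ → ℝ) (hc : c = FayHerriot.normIntegral ∨ c = FayHerriot.normClosed)
    -- finite set of candidates `0 = γ₁ < ⋯ < γ_M = 1`
    (Γ : Finset ℝ) (hΓ0 : (0 : ℝ) ∈ Γ) (hΓ1 : (1 : ℝ) ∈ Γ) (hΓ : ∀ γ ∈ Γ, 0 ≤ γ ∧ γ ≤ 1)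
    -- estimators `ψhat γ m` from the first `m` areas, and selected value `γop m`
    (ψhat : ℝ → ℕ → Ω → FayHerriot.Param p) (hψm : ∀ γ ∈ Γ, ∀ m, Measurable (ψhat γ m))
    (hψ : ∀ γ ∈ Γ, ∀ m, ∀ᵐ ω ∂P, FayHerriot.IsGammaEstimate c Ψ γ m
      (fun j => x j ω) (fun j => D j ω) (fun j => y j ω) (ψhat γ m ω))
    (γop : ℕ → Ω → ℝ) (hγm : ∀ m, Measurable (γop m))
    (hγ : ∀ m, ∀ᵐ ω ∂P, FayHerriot.IsOptimalGamma c Γ m (fun γ => ψhat γ m ω)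
      (fun j => x j ω) (fun j => D j ω) (fun j => y j ω) (γop m ω))
    (α : ℝ) (hα0 : 0 < α) (hα1 : α < 1) (i : ℕ) :
    Tendsto (fun m : ℕ => P.real {ω | θ i ω ∈ FayHerriot.robustInterval c α (γop m ω)
      (ψhat (γop m ω) m ω) (x i ω) (D i ω) (y i ω)}) atTop (𝓝 (1 - α)) := by
  obtain ⟨k, hk⟩ := FayHerriot.exists_isNormFactor hc
  exact theorem2_general (hx i) (hD i) (hθ i) (hy i) (hmodel i) (fun _ _ hne => hindep.indepFun hne)
    (fun j => (hident j).trans (hident i).symm) hDL (hDbd i) hX (hxX i) (hxpd i) hΨ hΨpos hmem hA hk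
    hΓ0 (fun γ hγ => (hΓ γ hγ).1) (hψm 0 hΓ0) hψ hγm hγ hα0 hα1
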